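/- Let $d\ge 3$ be an integer, let $\gamma\in\mathbb R$ with $\gamma<(d-2)/2$, and let $V$ be one of the two potentials $V(x)=\gamma\log|x|$ or $V(x)=\gamma\log\langle x\rangle$ on $\mathbb R^d$, where $\langle x\rangle=\sqrt{1+|x|^2}$. Write $\|\cdot\|_p$ for the norm of $L^p(\mathbb R^d,dx)$. Let $\mathcal C_{\mathrm{Nash}}\in(0,\infty)$ be the optimal (smallest) constant in Nash's inequality $$\|w\|_2^{2+\frac4d}\le \mathcal C_{\mathrm{Nash}}\,\|w\|_1^{\frac4d}\,\|\nabla w\|_2^2\qquad\text{for all } w\in L^1\cap H^1(\mathbb R^d).$$ (In particular, such a smallest constant exists, and it is positive.) Let $u_0\in L^1\cap L^2(\mathbb R^d)$ with $u_0\ge 0$ a.e., and let $u$ be any weak solution of the Fokker–Planck equation $$\partial_t u=\Delta u+\nabla\cdot(\nabla V\,u)\quad\text{on }(0,\infty)\times\mathbb R^d,\qquad u(0,\cdot)=u_0,$$ that is: $u\in C([0,\infty);L^2(\mathbb R^d))$, $\nabla u\in L^2((0,T)\times\mathbb R^d)$ for every $T>0$, $u(0,\cdot)=u_0$, and $$\int_{\mathbb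 R^d}u(t,x)\,\varphi(x)\,dx=\int_{\mathbb R^d}u_0\,\varphi\,dx-\int_0^t\int_{\mathbb R^d}\big(\nabla u+u\,\nabla V\big)\cdot\nabla\varphi\,dx\,ds$$ for all $t\ge0$ and all $\varphi\in C_c^\infty(\mathbb R^d)$. Then, for all $t\ge 0$, $$\|u(t,\cdot)\|_2^2\le\frac{\|u_0\|_2^2}{(1+c\,t)^{d/2}}\qquad\text{with}\qquad c=\frac4d\,\min\Big\{1,\,1-\frac{2\gamma}{d-2}\Big\}\,\mathcal C_{\mathrm{Nash}}^{-1}\,\frac{\|u_0\|_2^{4/d}}{\|u_0\|_1^{4/d}}$$ (if $u_0=0$, then $c$ is read as $0$). -/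

import Mathlib

open MeasureTheory Set
open scoped ContDiff Gradient RealInnerProductSpace

noncomputable section

namespace FokkerPlanck

/-- The Euclidean space `ℝ^d`. -/
abbrev E (d : ℕ) : Type := EuclideanSpace ℝ (Fin d)

/-- The potential `V₁(x) = γ log |x|`. -/
def potentialOne {d : ℕ} (γ : ℝ) : E d → ℝ :=
  fun x => γ * Real.log ‖x‖

/-- The potential `V₂(x) = γ log ⟨x⟩`, with `⟨x⟩ = √(1 + |x|²)`. -/
def potentialTwo {d : ℕ} (γ : ℝ) : E d → ℝ :=
  fun x => γ * Real.log (Real.sqrt (1 + ‖x‖ ^ 2))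

/-- `G` is the weak (distributional) gradient of `f` on `ℝ^d`. -/
structure HasWeakGradient {d : ℕ} (f : E d → ℝ) (G : E d → E d) : Prop where
  locallyIntegrable : LocallyIntegrable f volume
  locallyIntegrable_grad : LocallyIntegrable G volume
  integral_eq : ∀ φ : E d → ℝ, ContDiff ℝ ∞ φ → HasCompactSupport φ →
    ∫ x, f x • ∇ φ x = -∫ x, φ x • G x

/-- The real numbers `C` for which Nash's inequality
`‖u‖₂^(2+4/d) ≤ C ‖u‖₁^(4/d) ‖∇u‖₂²` holds for all `u ∈ L¹ ∩ H¹(ℝ^d)`. -/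
def nashConstants (d : ℕ) : Set ℝ :=
  {C | ∀ (u : E d → ℝ) (G : E d → E d), MemLp u 1 volume → MemLp u 2 volume →
    MemLp G 2 volume → HasWeakGradient u G →
    lpNorm u 2 volume ^ (2 + 4 / (d : ℝ)) ≤
      C * lpNorm u 1 volume ^ (4 / (d : ℝ)) * lpNorm G 2 volume ^ 2}

/-- The optimal constant in Nash's inequality on `ℝ^d`. -/
def nashConst (d : ℕ) : ℝ := sInf (nashConstants d)

/-- Weak (finite energy) solutions of `∂ₜu = Δu + ∇·(∇V u)` on `[0,∞) × ℝ^d` with initial datum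
`u₀`: `u ∈ C([0,∞); L²)`, `u(0) = u₀`, `∇u ∈ L²((0,T) × ℝ^d)` for every `T`, and the equation
holds against all smooth compactly supported functions of `x`, integrated in time from `0`
to `t`. -/
structure IsWeakSolution {d : ℕ} (V : E d → ℝ) (u₀ : E d → ℝ)
    (u : ℝ → Lp ℝ 2 (volume : Measure (E d))) : Prop where
  continuousOn : ContinuousOn u (Ici 0)
  initial : u 0 =ᵐ[volume] u₀
  equation : ∃ G : ℝ → Lp (E d) 2 (volume : Measure (E d)),
    (∀ T : ℝ, MemLp G 2 (volume.restrict (Ioc 0 T))) ∧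
    (∀ᵐ t ∂(volume.restrict (Ioi (0 : ℝ))), HasWeakGradient (u t) (G t)) ∧
    ∀ φ : E d → ℝ, ContDiff ℝ ∞ φ → HasCompactSupport φ → ∀ t : ℝ, 0 ≤ t →
      ∫ x, u t x * φ x =
        (∫ x, u₀ x * φ x) - ∫ s in (0 : ℝ)..t, ∫ x, ⟪G s x + u s x • ∇ V x, ∇ φ x⟫

/-- The constant `c = (4/d) min{1, 1 - 2γ/(d-2)} C_Nash⁻¹ ‖u₀‖₂^(4/d) / ‖u₀‖₁^(4/d)`. -/
def decayConst {d : ℕ} (γ : ℝ) (u₀ : E d → ℝ) : ℝ :=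
  4 / (d : ℝ) * min 1 (1 - 2 * γ / ((d : ℝ) - 2)) * (nashConst d)⁻¹ *
    (lpNorm u₀ 2 volume ^ (4 / (d : ℝ)) / lpNorm u₀ 1 volume ^ (4 / (d : ℝ)))

end FokkerPlanck

end

/-! Both potentials satisfy `∇V = γ a` with `a(x) = x/(η + |x|²)`, where `η` is `0` or `1`.
Formally, testing the equation with `u` gives `d/dt ‖u‖₂² = -2(X + γI)`, where `X = ‖∇u‖₂²` and `I =
∫ u a·∇u`. Since `div a ≥ (d-2)|a|²`, integration by parts yields `-I ≥ ((d-2)/2) ∫ u²|a|² ≥ 0`.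
Expanding `∫ |∇u + ((d-2)/2) u a|² ≥ 0` then yields `-I ≤ (2/(d-2)) X`. Hence `X + γI ≥ κX` with `κ
= min{1, 1 - 2γ/(d-2)} > 0` (`HardyWeight.dissipation`). Once `‖u(t)‖₁ ≤ ‖u₀‖₁` is known, Nash's
inequality turns this into `y' ≤ -A y^(1+2/d)` for `y = ‖u‖₂²`, with `A = 2κ/(C_Nash ‖u₀‖₁^(4/d))`,
and integration gives the claim (`le_div_rpow_of_sub_le`).

The `L¹` bound is the same computation for the convex function `j(s) = √(s²+ε²) - ε` in place of
`s²/2`. The test function is `j'(u)`, and all the integrals acquire the weight `ζ = j''(u) ≥ 0`. The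
Hardy argument survives because the primitive `h` of `sζ(s)` satisfies `s²ζ(s) ≤ 2h(s)`, which is
what `HardyWeight` records. So `∫ j(u)` does not increase, and `ε → 0` gives the bound.

A weak solution has no time derivative in `L²`, so the chain rule is replaced by convexity: `j(u(t))
- j(u(s)) ≤ j'(u(t))(u(t) - u(s))` for `s ≤ t`. The right side is computed from the weak formulation
with the test function frozen at the later time `t` (`increment_le`). Replacing the time average of
the flux over `[s,t]` by its value at `t` costs an error that vanishes in `L²` in time, because
backward Steklov averages converge; this is `sub_le_neg_integral_of_increment_le`. The flux is
square integrable in space and time by Hardy's inequality, even for the singular potential. -/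

namespace FokkerPlanck

open Filter Topology
open scoped ENNReal NNReal

/-! ### Approximation in `L²` by averages of translates -/

section Averages

variable {V X : Type*} [NormedAddCommGroup V] [NormedSpace ℝ V] [MeasurableSpace V] [BorelSpace V]
  [FiniteDimensional ℝ V] [NormedAddCommGroup X]

/-- Translations act continuously on `L²`. -/
lemma exists_eLpNorm_sub_translate_le (μ : Measure V) [μ.IsAddHaarMeasure] {F : V → X}
    (hF : MemLp F 2 μ) {δ : ℝ≥0∞} (hδ : 0 < δ) :
    ∃ r > 0, ∀ y : V, ‖y‖ ≤ r → eLpNorm (fun x => F x - F (x - y)) 2 μ ≤ δ := by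
  let T : V → C(V, V) := fun y => ⟨fun x => x - y, by fun_prop⟩
  have hT : Continuous T := by
    refine ContinuousMap.continuous_of_continuous_uncurry _ ?_
    simp only [T, Function.uncurry_def, ContinuousMap.coe_mk]
    fun_prop
  have hTm : ∀ y, MeasurePreserving (T y) μ μ := fun y => measurePreserving_sub_right μ y
  have hc : Continuous fun y => Lp.compMeasurePreserving (T y) (hTm y) (hF.toLp F) :=
    continuous_const.compMeasurePreservingLp hT hTm (by norm_num)
  have h0 := (EMetric.tendsto_nhds.1 (hc.tendsto 0)) δ hδ
  obtain ⟨r, hr, hb⟩ := Metric.eventually_nhds_iff.1 h0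
  refine ⟨r / 2, by positivity, fun y hy => ?_⟩
  have := hb (y := y) (by rw [dist_zero_right]; linarith)
  rw [edist_comm, Lp.edist_def] at this
  refine (le_of_eq (eLpNorm_congr_ae ?_)).trans this.le
  have h1 := Lp.coeFn_compMeasurePreserving (hF.toLp F) (hTm y)
  have h2 := Lp.coeFn_compMeasurePreserving (hF.toLp F) (hTm 0)
  have h3 := hF.coeFn_toLp
  have h4 := (hTm y).quasiMeasurePreserving.ae h3
  have h5 := (hTm 0).quasiMeasurePreserving.ae h3
  filter_upwards [h1, h2, h3, h4, h5] with x h1 h2 h3 h4 h5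
  simp only [Pi.sub_apply, h1, h2, Function.comp, h4, h5]
  simp [T]

/-- Averages of an `L²` function over small translations are close to the function in `L²`. -/
lemma exists_eLpNorm_sub_average_le [NormedSpace ℝ X] [CompleteSpace X] (μ : Measure V) [μ.IsAddHaarMeasure]
    {F : V → X} (hF : MemLp F 2 μ) {δ : ℝ≥0∞} (hδ : 0 < δ) :
    ∃ r > 0, ∀ ν : Measure V, IsProbabilityMeasure ν → (∀ᵐ y ∂ν, ‖y‖ ≤ r) →
      eLpNorm (fun x => F x - ∫ y, F (x - y) ∂ν) 2 μ ≤ δ := by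
  by_cases hδt : δ = ⊤
  · exact ⟨1, one_pos, fun ν _ _ => by simp [hδt]⟩
  obtain ⟨r, hr, hT⟩ := exists_eLpNorm_sub_translate_le μ hF hδ
  refine ⟨r, hr, fun ν _ hν => ?_⟩
  have hsq : ∀ f : V → X, ∀ m : Measure V, eLpNorm f 2 m ^ 2 = ∫⁻ x, ‖f x‖ₑ ^ 2 ∂m := fun f m => by
    have := eLpNorm_nnreal_pow_eq_lintegral (μ := m) (f := f) (p := 2) (by norm_num)
    simpa using this
  have hm : AEStronglyMeasurable (fun p : V × V => F p.1 - F (p.1 - p.2)) (μ.prod ν) :=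
    (hF.1.comp_fst).sub (hF.1.comp_quasiMeasurePreserving
      (quasiMeasurePreserving_sub_of_right_invariant μ ν))
  -- Tonelli: each translate contributes at most `δ²`, and `ν` has total mass one.
  have hdouble : ∫⁻ x, ∫⁻ y, ‖F x - F (x - y)‖ₑ ^ 2 ∂ν ∂μ ≤ δ ^ 2 := by
    rw [lintegral_lintegral_swap (by exact (hm.enorm.pow_const 2))]
    calc ∫⁻ y, ∫⁻ x, ‖F x - F (x - y)‖ₑ ^ 2 ∂μ ∂ν ≤ ∫⁻ _, δ ^ 2 ∂ν := by
          refine lintegral_mono_ae ?_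
          filter_upwards [hν] with y hy
          rw [← hsq (fun x => F x - F (x - y))]
          exact pow_le_pow_left₀ (zero_le) (hT y hy) 2
      _ = δ ^ 2 := by simp
  have hfin : ∀ᵐ x ∂μ, ∫⁻ y, ‖F x - F (x - y)‖ₑ ^ 2 ∂ν < ⊤ :=
    ae_lt_top' ((hm.enorm.pow_const 2).lintegral_prod_right')
      (hdouble.trans_lt (ENNReal.pow_lt_top (lt_top_iff_ne_top.2 hδt))).ne
  have hmx : ∀ᵐ x ∂μ, AEStronglyMeasurable (fun y => F x - F (x - y)) ν := hm.prodMk_left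
  -- Jensen for the probability measure `ν`, in the form `L¹` norm at most `L²` norm.
  have hpt : ∀ᵐ x ∂μ, ‖F x - ∫ y, F (x - y) ∂ν‖ₑ ^ 2 ≤ ∫⁻ y, ‖F x - F (x - y)‖ₑ ^ 2 ∂ν := by
    filter_upwards [hfin, hmx] with x hx hmx
    have hL2 : MemLp (fun y => F x - F (x - y)) 2 ν := by
      refine ⟨hmx, ?_⟩
      rw [← hsq] at hx
      exact (ENNReal.pow_lt_top_iff.1 hx).resolve_right (by norm_num)
    have hint : Integrable (fun y => F x - F (x - y)) ν := hL2.integrable (by norm_num)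
    have hint2 : Integrable (fun y => F (x - y)) ν := by
      refine ((integrable_const (F x)).sub hint).congr (.of_forall fun y => ?_)
      simp
    have heq : F x - ∫ y, F (x - y) ∂ν = ∫ y, (F x - F (x - y)) ∂ν := by
      rw [integral_sub (integrable_const _) hint2]; simp
    rw [heq, ← hsq]
    refine pow_le_pow_left₀ zero_le ?_ 2
    calc _ ≤ ∫⁻ y, ‖F x - F (x - y)‖ₑ ∂ν := enorm_integral_le_lintegral_enorm _
      _ = eLpNorm (fun y => F x - F (x - y)) 1 ν := eLpNorm_one_eq_lintegral_enorm.symm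
      _ ≤ _ := eLpNorm_le_eLpNorm_of_exponent_le (by norm_num) hmx
  rw [← ENNReal.pow_le_pow_left_iff (n := 2) (by norm_num), hsq]
  exact (lintegral_mono_ae hpt).trans hdouble

end Averages

/-! ### Convergence of inner products and norms in `L²` -/

section Limits

variable {α H : Type*} [MeasurableSpace α] {μ : Measure α} [NormedAddCommGroup H]
  [InnerProductSpace ℝ H]

lemma integrable_inner_of_memLp {f g : α → H} (hf : MemLp f 2 μ) (hg : MemLp g 2 μ) :
    Integrable (fun x => ⟪f x, g x⟫) μ := by
  refine (L2.integrable_inner (𝕜 := ℝ) (hf.toLp f) (hg.toLp g)).congr ?_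
  filter_upwards [hf.coeFn_toLp, hg.coeFn_toLp] with x h1 h2
  rw [h1, h2]

lemma inner_toLp {f g : α → H} (hf : MemLp f 2 μ) (hg : MemLp g 2 μ) :
    ⟪hf.toLp f, hg.toLp g⟫ = ∫ x, ⟪f x, g x⟫ ∂μ := by
  rw [L2.inner_def]
  refine integral_congr_ae ?_
  filter_upwards [hf.coeFn_toLp, hg.coeFn_toLp] with x h1 h2
  rw [h1, h2]

lemma tendsto_integral_inner_of_eLpNorm {f g : ℕ → α → H} {f₀ g₀ : α → H}
    (hf : ∀ n, MemLp (f n) 2 μ) (hg : ∀ n, MemLp (g n) 2 μ) (hf₀ : MemLp f₀ 2 μ)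
    (hg₀ : MemLp g₀ 2 μ) (hfl : Tendsto (fun n => eLpNorm (f n - f₀) 2 μ) atTop (𝓝 0))
    (hgl : Tendsto (fun n => eLpNorm (g n - g₀) 2 μ) atTop (𝓝 0)) :
    Tendsto (fun n => ∫ x, ⟪f n x, g n x⟫ ∂μ) atTop (𝓝 (∫ x, ⟪f₀ x, g₀ x⟫ ∂μ)) := by
  simp_rw [fun n => (inner_toLp (hf n) (hg n)).symm, ← inner_toLp hf₀ hg₀]
  refine Tendsto.inner ?_ ?_
  · exact (Lp.tendsto_Lp_iff_tendsto_eLpNorm'' _ hf _ hf₀).2 hfl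
  · exact (Lp.tendsto_Lp_iff_tendsto_eLpNorm'' _ hg _ hg₀).2 hgl

lemma tendsto_eLpNorm_of_norm_le_mul {Y Z : Type*} [NormedAddCommGroup Y] [NormedAddCommGroup Z]
    {f : ℕ → α → Y} {g : ℕ → α → Z} (C : ℝ) (h : ∀ n, ∀ᵐ x ∂μ, ‖f n x‖ ≤ C * ‖g n x‖)
    (hg : Tendsto (fun n => eLpNorm (g n) 2 μ) atTop (𝓝 0)) :
    Tendsto (fun n => eLpNorm (f n) 2 μ) atTop (𝓝 0) := by
  refine tendsto_of_tendsto_of_tendsto_of_le_of_le tendsto_const_nhds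
    (h := fun n => ENNReal.ofReal C * eLpNorm (g n) 2 μ) ?_ (fun _ => zero_le) fun n =>
      eLpNorm_le_mul_eLpNorm_of_ae_le_mul (h n) 2
  simpa using ENNReal.Tendsto.const_mul hg (Or.inr ENNReal.ofReal_ne_top)

/-- Dominated convergence in `L²`. -/
lemma tendsto_eLpNorm_of_dominated {Y : Type*} [NormedAddCommGroup Y] {f : ℕ → α → Y} {b : α → ℝ}
    (hf : ∀ n, AEStronglyMeasurable (f n) μ) (hb : MemLp b 2 μ)
    (hle : ∀ n, ∀ᵐ x ∂μ, ‖f n x‖ ≤ b x)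
    (hlim : ∀ᵐ x ∂μ, Tendsto (fun n => f n x) atTop (𝓝 0)) :
    Tendsto (fun n => eLpNorm (f n) 2 μ) atTop (𝓝 0) := by
  have hsq : ∀ g : α → Y,
      eLpNorm g 2 μ = (∫⁻ x, ‖g x‖ₑ ^ 2 ∂μ) ^ (1 / 2 : ℝ) := fun g => by
    rw [eLpNorm_eq_lintegral_rpow_enorm_toReal (by norm_num) (by norm_num)]
    simp
  simp only [hsq]
  have hfin : ∫⁻ x, ‖b x‖ₑ ^ 2 ∂μ ≠ ⊤ := by
    have := hb.2.ne
    rw [eLpNorm_eq_lintegral_rpow_enorm_toReal (by norm_num) (by norm_num)] at this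
    intro h
    simp [h] at this
  have h0 : Tendsto (fun n => ∫⁻ x, ‖f n x‖ₑ ^ 2 ∂μ) atTop (𝓝 (∫⁻ _, 0 ∂μ)) := by
    refine tendsto_lintegral_of_dominated_convergence' (fun x => ‖b x‖ₑ ^ 2)
      (fun n => (hf n).enorm.pow_const 2) (fun n => ?_) hfin ?_
    · filter_upwards [hle n] with x hx
      refine pow_le_pow_left₀ zero_le ?_ 2
      exact enorm_le_iff_norm_le.2 (hx.trans (le_abs_self _))
    · filter_upwards [hlim] with x hx
      have := ENNReal.Tendsto.pow (n := 2) hx.enorm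
      simpa using this
  rw [lintegral_zero] at h0
  have := h0.ennrpow_const (1 / 2)
  simpa using this

end Limits

/-! ### Calculus rules for gradients -/

section Gradient

variable {H : Type*} [NormedAddCommGroup H] [InnerProductSpace ℝ H] [CompleteSpace H]

lemma gradient_mul_apply {f g : H → ℝ} {x : H} (hf : DifferentiableAt ℝ f x)
    (hg : DifferentiableAt ℝ g x) :
    ∇ (fun y => f y * g y) x = f x • ∇ g x + g x • ∇ f x := by
  unfold gradient
  rw [fderiv_fun_mul hf hg, map_add, map_smulₛₗ, map_smulₛₗ]
  simp

lemma gradient_comp_apply {β : ℝ → ℝ} {f : H → ℝ} {x : H} (hβ : DifferentiableAt ℝ β (f x))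
    (hf : DifferentiableAt ℝ f x) :
    ∇ (fun y => β (f y)) x = deriv β (f x) • ∇ f x := by
  unfold gradient
  have : fderiv ℝ (fun y => β (f y)) x = deriv β (f x) • fderiv ℝ f x :=
    (hβ.hasDerivAt.comp_hasFDerivAt x hf.hasFDerivAt).fderiv
  rw [this, map_smulₛₗ]
  simp

lemma continuous_gradient {f : H → ℝ} (hf : ContDiff ℝ 1 f) : Continuous (∇ f) :=
  (InnerProductSpace.toDual ℝ H).symm.continuous.comp (hf.continuous_fderiv one_ne_zero)

lemma _root_.HasCompactSupport.gradient {f : H → ℝ} (hf : HasCompactSupport f) :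
    HasCompactSupport (∇ f) :=
  (hf.fderiv (𝕜 := ℝ)).comp_left (g := (InnerProductSpace.toDual ℝ H).symm) (map_zero _)

lemma norm_gradient (f : H → ℝ) (x : H) : ‖∇ f x‖ = ‖fderiv ℝ f x‖ := by
  simp [gradient]

lemma gradient_comp_const_smul {f : H → ℝ} (hf : Differentiable ℝ f) (c : ℝ) (x : H) :
    ∇ (fun y => f (c • y)) x = c • ∇ f (c • x) := by
  unfold gradient
  have : fderiv ℝ (fun y => f (c • y)) x = c • fderiv ℝ f (c • x) := by
    have h := (hf (c • x)).hasFDerivAt.comp x ((hasFDerivAt_id x).const_smul c)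
    refine h.fderiv.trans ?_
    ext v
    simp
  rw [this, map_smulₛₗ]
  simp

lemma gradient_comp_sub_left {f : H → ℝ} (hf : Differentiable ℝ f) (c x : H) :
    ∇ (fun y => f (c - y)) x = -∇ f (c - x) := by
  unfold gradient
  have : fderiv ℝ (fun y => f (c - y)) x = -fderiv ℝ f (c - x) := by
    have h := (hf (c - x)).hasFDerivAt.comp x ((hasFDerivAt_id x).const_sub c)
    refine h.fderiv.trans ?_
    ext v
    simp
  rw [this, map_neg]

end Gradient

/-! ### Density of test functions in `H¹` and the chain rule -/

variable {d : ℕ}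

lemma memLp_of_contDiff {f : E d → ℝ} (hf : ContDiff ℝ ∞ f) (hc : HasCompactSupport f)
    (p : ℝ≥0∞) : MemLp f p volume :=
  hf.continuous.memLp_of_hasCompactSupport hc

lemma memLp_gradient_of_contDiff {f : E d → ℝ} (hf : ContDiff ℝ ∞ f) (hc : HasCompactSupport f)
    (p : ℝ≥0∞) : MemLp (∇ f) p volume :=
  (continuous_gradient (hf.of_le (by simp))).memLp_of_hasCompactSupport hc.gradient

/-- `φ` is a sequence of test functions that converges to `u` in `L²` and whose gradients
converge to `G` in `L²`. -/
structure ApproxH1 (u : E d → ℝ) (G : E d → E d) (φ : ℕ → E d → ℝ) : Prop where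
  contDiff : ∀ n, ContDiff ℝ ∞ (φ n)
  hasCompactSupport : ∀ n, HasCompactSupport (φ n)
  tendsto : Tendsto (fun n => eLpNorm (φ n - u) 2 volume) atTop (𝓝 0)
  tendsto_grad : Tendsto (fun n => eLpNorm (∇ (φ n) - G) 2 volume) atTop (𝓝 0)

/-- Mollification by a bump `ρ`. Both `u * ρ` and its gradient `G * ρ` are averages of translates
against the probability measure with density `ρ`, so one radius makes both errors small. -/
lemma HasWeakGradient.exists_contDiff_approx {u : E d → ℝ} {G : E d → E d}
    (h : HasWeakGradient u G) (hu : MemLp u 2 volume) (hG : MemLp G 2 volume) {δ : ℝ≥0∞}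
    (hδ : 0 < δ) :
    ∃ w : E d → ℝ, ContDiff ℝ ∞ w ∧ eLpNorm (w - u) 2 volume ≤ δ ∧
      eLpNorm (∇ w - G) 2 volume ≤ δ := by
  obtain ⟨r₁, hr₁, H₁⟩ := exists_eLpNorm_sub_average_le volume hu hδ
  obtain ⟨r₂, hr₂, H₂⟩ := exists_eLpNorm_sub_average_le volume hG hδ
  set r := min r₁ r₂ with hrdef
  have hr : 0 < r := lt_min hr₁ hr₂
  let b : ContDiffBump (0 : E d) := ⟨r / 2, r, by positivity, by linarith⟩
  set ρ : E d → ℝ := b.normed volume with hρ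
  have hρ0 : ∀ x, 0 ≤ ρ x := b.nonneg_normed
  have hρs : ContDiff ℝ ∞ ρ := b.contDiff_normed
  have hρc : HasCompactSupport ρ := b.hasCompactSupport_normed
  have hρi : Integrable ρ volume := b.integrable_normed
  let ν : Measure (E d) := volume.withDensity fun x => ENNReal.ofReal (ρ x)
  have hν : IsProbabilityMeasure ν := by
    constructor
    rw [withDensity_apply _ MeasurableSet.univ, Measure.restrict_univ,
      ← ofReal_integral_eq_lintegral_ofReal hρi (.of_forall hρ0), b.integral_normed]
    simp
  have hνr : ∀ᵐ y ∂ν, ‖y‖ ≤ r := by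
    rw [ae_withDensity_iff (hρs.continuous.measurable.ennreal_ofReal)]
    refine .of_forall fun y hy => ?_
    have : y ∈ Function.support ρ := fun h => hy (by simp [h])
    rw [hρ, b.support_normed_eq, Metric.mem_ball, dist_zero_right] at this
    exact this.le
  have hνint : ∀ {Y : Type} [NormedAddCommGroup Y] [NormedSpace ℝ Y] (f : E d → Y) (x : E d),
      ∫ y, f (x - y) ∂ν = ∫ t, ρ (x - t) • f t := by
    intro Y _ _ f x
    have e : ν = volume.withDensity fun x => ((Real.toNNReal (ρ x) : ℝ≥0) : ℝ≥0∞) := rfl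
    rw [e, integral_withDensity_eq_integral_smul hρs.continuous.measurable.real_toNNReal,
      ← integral_sub_left_eq_self _ volume x]
    refine integral_congr_ae (.of_forall fun t => ?_)
    simp [NNReal.smul_def, Real.coe_toNNReal _ (hρ0 _)]
  let w : E d → ℝ := convolution u ρ (ContinuousLinearMap.lsmul ℝ ℝ) volume
  have hw : ∀ x, w x = ∫ y, u (x - y) ∂ν := fun x => by
    rw [hνint]
    refine integral_congr_ae (.of_forall fun t => ?_)
    simp [mul_comm]
  -- The derivative falls on `ρ`, and the weak gradient tested against `t ↦ ρ(x - t)` moves it to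
  -- `u`. The sign from the reflection cancels the sign from the integration by parts.
  have hgw : ∀ x, ∇ w x = ∫ y, G (x - y) ∂ν := fun x => by
    rw [hνint]
    have h1 := (hρc.hasFDerivAt_convolution_right (ContinuousLinearMap.lsmul ℝ ℝ)
      h.locallyIntegrable (hρs.of_le (by simp)) x).fderiv
    have h2 := h.integral_eq (fun t => ρ (x - t)) (hρs.comp (by fun_prop))
      (hρc.comp_homeomorph (Homeomorph.subLeft x))
    rw [← neg_eq_iff_eq_neg] at h2
    rw [← h2]
    unfold gradient
    rw [h1, convolution_def, ← integral_neg]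
    have hcomm := ((InnerProductSpace.toDual ℝ (E d)).symm.toContinuousLinearEquiv).integral_comp_comm
      (μ := volume) (fun t => ((ContinuousLinearMap.precompR (E d)
        (ContinuousLinearMap.lsmul ℝ ℝ)) (u t)) (fderiv ℝ ρ (x - t)))
    refine hcomm.symm.trans ?_
    refine integral_congr_ae (.of_forall fun t => ?_)
    have h3 := gradient_comp_sub_left (hρs.differentiable (by simp)) x t
    unfold gradient at h3
    simp only [h3, smul_neg, neg_neg]
    have h4 : (ContinuousLinearMap.precompR (E d) (ContinuousLinearMap.lsmul ℝ ℝ)) (u t)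
        (fderiv ℝ ρ (x - t)) = u t • fderiv ℝ ρ (x - t) := by
      ext v; simp
    rw [h4]
    exact ((InnerProductSpace.toDual ℝ (E d)).symm.map_smulₛₗ _ _).trans (by simp)
  refine ⟨w, hρc.contDiff_convolution_right _ h.locallyIntegrable hρs, ?_, ?_⟩
  · rw [eLpNorm_sub_comm]
    refine le_of_eq_of_le (eLpNorm_congr_ae (.of_forall fun x => ?_))
      (H₁ ν hν (hνr.mono fun y hy => hy.trans (min_le_left _ _)))
    simp [hw]
  · rw [eLpNorm_sub_comm]
    refine le_of_eq_of_le (eLpNorm_congr_ae (.of_forall fun x => ?_))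
      (H₂ ν hν (hνr.mono fun y hy => hy.trans (min_le_right _ _)))
    simp [hgw]

/-- Multiplication by the cutoffs `b(x/(n+1))`. Both limits follow by dominated convergence, the
commutator term `w ∇(b(x/(n+1)))` being `O(1/(n+1))` pointwise. -/
lemma exists_approx_of_contDiff {w : E d → ℝ} (hw : ContDiff ℝ ∞ w) (hw2 : MemLp w 2 volume)
    (hg2 : MemLp (∇ w) 2 volume) : ∃ φ, ApproxH1 w (∇ w) φ := by
  let b : ContDiffBump (0 : E d) := ⟨1, 2, by norm_num, by norm_num⟩
  have hbs : ContDiff ℝ ∞ b := b.contDiff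
  have hbd : Differentiable ℝ b := hbs.differentiable (by simp)
  obtain ⟨C, hC⟩ := (continuous_gradient (hbs.of_le (by simp))).bounded_above_of_compact_support
    b.hasCompactSupport.gradient
  have hC0 : 0 ≤ C := (norm_nonneg _).trans (hC 0)
  let c : ℕ → ℝ := fun n => 1 / ((n : ℝ) + 1)
  have hc0 : ∀ n, 0 < c n := fun n => by positivity
  have hc1 : ∀ n, c n ≤ 1 := fun n => by
    simp only [c]; rw [div_le_one (by positivity)]; linarith [(Nat.cast_nonneg n : (0:ℝ) ≤ n)]
  have hclim : Tendsto c atTop (𝓝 0) := tendsto_one_div_add_atTop_nhds_zero_nat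
  have hbc : ∀ n, ContDiff ℝ ∞ fun x : E d => b (c n • x) := fun n => hbs.comp (by fun_prop)
  have hone : ∀ x : E d, ∀ᶠ n in atTop, b (c n • x) = 1 := fun x => by
    have : Tendsto (fun n => ‖c n • x‖) atTop (𝓝 0) := by
      have := (hclim.smul_const x).norm
      simpa using this
    filter_upwards [this.eventually_le_const (u := 1) one_pos] with n hn
    exact b.one_of_mem_closedBall (by simpa using hn)
  have hgrad : ∀ n x, ∇ (fun y => b (c n • y) * w y) x =
      b (c n • x) • ∇ w x + w x • (c n • ∇ b (c n • x)) := fun n x => by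
    rw [gradient_mul_apply ((hbc n).differentiable (by simp) x) (hw.differentiable (by simp) x),
      gradient_comp_const_smul hbd]
  have hgc : ∀ n, Continuous (∇ (fun y => b (c n • y) * w y)) := fun n =>
    continuous_gradient (((hbc n).mul hw).of_le (by simp))
  refine ⟨fun n x => b (c n • x) * w x, fun n => (hbc n).mul hw, fun n => ?_, ?_, ?_⟩
  · exact (b.hasCompactSupport.comp_homeomorph (Homeomorph.smulOfNeZero (c n) (hc0 n).ne')).mul_right
  · refine tendsto_eLpNorm_of_dominated (b := fun x => ‖w x‖) (fun n => ?_) hw2.norm (fun n => ?_) ?_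
    · exact (((hbc n).mul hw).continuous.sub hw.continuous).aestronglyMeasurable
    · refine .of_forall fun x => ?_
      have h1 : |b (c n • x) - 1| ≤ 1 := by
        rw [abs_le]; constructor <;> linarith [b.nonneg (x := c n • x), b.le_one (x := c n • x)]
      calc ‖b (c n • x) * w x - w x‖ = |b (c n • x) - 1| * ‖w x‖ := by
            rw [← sub_one_mul, norm_mul, Real.norm_eq_abs]
        _ ≤ 1 * ‖w x‖ := by gcongr
        _ = ‖w x‖ := one_mul _
    · refine .of_forall fun x => tendsto_const_nhds.congr' ?_
      filter_upwards [hone x] with n hn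
      simp [hn]
  · refine tendsto_eLpNorm_of_dominated (b := fun x => ‖∇ w x‖ + C * ‖w x‖) (fun n => ?_)
      (hg2.norm.add (hw2.norm.const_mul C)) (fun n => ?_) ?_
    · exact ((hgc n).sub (continuous_gradient (hw.of_le (by simp)))).aestronglyMeasurable
    · refine .of_forall fun x => ?_
      have h1 : |b (c n • x) - 1| ≤ 1 := by
        rw [abs_le]; constructor <;> linarith [b.nonneg (x := c n • x), b.le_one (x := c n • x)]
      have e : (∇ (fun y => b (c n • y) * w y) - ∇ w) x =
          (b (c n • x) - 1) • ∇ w x + w x • (c n • ∇ b (c n • x)) := by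
        rw [Pi.sub_apply, hgrad, sub_smul, one_smul]; abel
      rw [e]
      refine (norm_add_le _ _).trans ?_
      rw [norm_smul, norm_smul, norm_smul, Real.norm_eq_abs, Real.norm_eq_abs, Real.norm_eq_abs,
        abs_of_pos (hc0 n)]
      have h2 : c n * ‖∇ b (c n • x)‖ ≤ 1 * C :=
        mul_le_mul (hc1 n) (hC _) (norm_nonneg _) zero_le_one
      have h3 := mul_le_mul_of_nonneg_left h2 (abs_nonneg (w x))
      have h4 := mul_le_mul_of_nonneg_right h1 (norm_nonneg (∇ w x))
      linarith
    · refine .of_forall fun x => ?_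
      have h1 : Tendsto (fun n => w x • (c n • ∇ b (c n • x))) atTop (𝓝 0) := by
        refine squeeze_zero_norm (a := fun n => ‖w x‖ * C * c n) (fun n => ?_) ?_
        · rw [norm_smul, norm_smul, Real.norm_of_nonneg (hc0 n).le, mul_assoc]
          rw [mul_comm C]
          exact mul_le_mul_of_nonneg_left (mul_le_mul_of_nonneg_left (hC _) (hc0 n).le)
            (norm_nonneg _)
        · simpa using hclim.const_mul (‖w x‖ * C)
      refine h1.congr' ?_
      filter_upwards [hone x] with n hn
      rw [Pi.sub_apply, hgrad, hn]; simp

/-- Test functions are dense in `H¹`. -/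
lemma HasWeakGradient.exists_approx {u : E d → ℝ} {G : E d → E d} (h : HasWeakGradient u G)
    (hu : MemLp u 2 volume) (hG : MemLp G 2 volume) : ∃ φ, ApproxH1 u G φ := by
  have key : ∀ n : ℕ, ∃ φ : E d → ℝ, ContDiff ℝ ∞ φ ∧ HasCompactSupport φ ∧
      eLpNorm (φ - u) 2 volume ≤ 2 * ((n : ℝ≥0∞) + 1)⁻¹ ∧
      eLpNorm (∇ φ - G) 2 volume ≤ 2 * ((n : ℝ≥0∞) + 1)⁻¹ := fun n => by
    have hδ : 0 < ((n : ℝ≥0∞) + 1)⁻¹ := by simp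
    have hδt : ((n : ℝ≥0∞) + 1)⁻¹ < ⊤ := by simp
    obtain ⟨w, hw, h1, h2⟩ := h.exists_contDiff_approx hu hG hδ
    have hgw := continuous_gradient (hw.of_le (by simp) : ContDiff ℝ 1 w)
    have hw2 : MemLp w 2 volume := by
      have : MemLp (w - u) 2 volume :=
        ⟨hw.continuous.aestronglyMeasurable.sub hu.1, h1.trans_lt hδt⟩
      simpa using this.add hu
    have hgw2 : MemLp (∇ w) 2 volume := by
      have : MemLp (∇ w - G) 2 volume := ⟨hgw.aestronglyMeasurable.sub hG.1, h2.trans_lt hδt⟩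
      simpa using this.add hG
    obtain ⟨φ, hφ⟩ := exists_approx_of_contDiff hw hw2 hgw2
    obtain ⟨m, hm1, hm2⟩ := ((hφ.tendsto.eventually_le_const hδ).and
      (hφ.tendsto_grad.eventually_le_const hδ)).exists
    refine ⟨φ m, hφ.contDiff m, hφ.hasCompactSupport m, ?_, ?_⟩
    · have e : φ m - u = (φ m - w) + (w - u) := by abel
      rw [e, two_mul]
      refine (eLpNorm_add_le ?_ ?_ (by norm_num)).trans (add_le_add hm1 h1)
      · exact ((hφ.contDiff m).continuous.sub hw.continuous).aestronglyMeasurable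
      · exact hw.continuous.aestronglyMeasurable.sub hu.1
    · have e : ∇ (φ m) - G = (∇ (φ m) - ∇ w) + (∇ w - G) := by abel
      rw [e, two_mul]
      refine (eLpNorm_add_le ?_ ?_ (by norm_num)).trans (add_le_add hm2 h2)
      · exact ((continuous_gradient ((hφ.contDiff m).of_le (by simp))).sub
          hgw).aestronglyMeasurable
      · exact hgw.aestronglyMeasurable.sub hG.1
  choose φ h1 h2 h3 h4 using key
  have hlim : Tendsto (fun n : ℕ => 2 * ((n : ℝ≥0∞) + 1)⁻¹) atTop (𝓝 0) := by
    have : Tendsto (fun n : ℕ => ((n : ℝ≥0∞) + 1)⁻¹) atTop (𝓝 0) := by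
      have := (tendsto_add_atTop_iff_nat 1).2 ENNReal.tendsto_inv_nat_nhds_zero
      simpa using this
    simpa using ENNReal.Tendsto.const_mul this (Or.inr (by norm_num))
  exact ⟨φ, h1, h2, tendsto_of_tendsto_of_tendsto_of_le_of_le tendsto_const_nhds hlim
    (fun _ => zero_le) h3, tendsto_of_tendsto_of_tendsto_of_le_of_le tendsto_const_nhds hlim
    (fun _ => zero_le) h4⟩

/-- The chain rule in `H¹`, which makes `β(u)` an admissible test function. The approximants are `β
∘ φ` along a subsequence. -/
lemma ApproxH1.comp {u : E d → ℝ} {G : E d → E d} {φ : ℕ → E d → ℝ} (h : ApproxH1 u G φ)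
    (hu : MemLp u 2 volume) (hG : MemLp G 2 volume) {β : ℝ → ℝ} (hβ : ContDiff ℝ ∞ β)
    (hβ0 : β 0 = 0) {B : ℝ} (hB : ∀ s, |deriv β s| ≤ B) :
    ∃ ψ, ApproxH1 (fun x => β (u x)) (fun x => deriv β (u x) • G x) ψ := by
  have hB0 : 0 ≤ B := (abs_nonneg _).trans (hB 0)
  have hβd : Differentiable ℝ β := hβ.differentiable (by simp)
  have hβc : Continuous (deriv β) := hβ.continuous_deriv (by simp)
  have hlip : ∀ a b, ‖β a - β b‖ ≤ B * ‖a - b‖ := fun a b =>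
    Convex.norm_image_sub_le_of_norm_deriv_le (fun x _ => hβd x) (fun x _ => hB x) convex_univ
      (mem_univ b) (mem_univ a)
  have hφm : ∀ n, AEStronglyMeasurable (φ n) volume := fun n =>
    (h.contDiff n).continuous.aestronglyMeasurable
  -- Almost everywhere convergence is needed because `deriv β` is only continuous and bounded:
  -- `deriv β(φ) • G` is handled by dominated convergence.
  obtain ⟨k, hk, hae⟩ := (tendstoInMeasure_of_tendsto_eLpNorm (by norm_num) hφm hu.1
    h.tendsto).exists_seq_tendsto_ae
  refine ⟨fun n x => β (φ (k n) x), fun n => hβ.comp (h.contDiff _),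
    fun n => (h.hasCompactSupport _).comp_left hβ0, ?_, ?_⟩
  · exact tendsto_eLpNorm_of_norm_le_mul B (fun n => .of_forall fun x => hlip _ _)
      (h.tendsto.comp hk.tendsto_atTop)
  · have hgm : ∀ n, AEStronglyMeasurable (∇ (φ n)) volume := fun n =>
      (continuous_gradient ((h.contDiff n).of_le (by simp))).aestronglyMeasurable
    have hdm : ∀ n, AEStronglyMeasurable (fun x => deriv β (φ (k n) x)) volume := fun n =>
      hβc.comp_aestronglyMeasurable (hφm _)
    have hdu : AEStronglyMeasurable (fun x => deriv β (u x)) volume :=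
      hβc.comp_aestronglyMeasurable hu.1
    have h1 : Tendsto (fun n => eLpNorm (fun x => deriv β (φ (k n) x) • (∇ (φ (k n)) - G) x)
        2 volume) atTop (𝓝 0) := by
      refine tendsto_eLpNorm_of_norm_le_mul B (fun n => .of_forall fun x => ?_)
        (h.tendsto_grad.comp hk.tendsto_atTop)
      rw [norm_smul]
      exact mul_le_mul_of_nonneg_right (hB _) (norm_nonneg _)
    have h2 : Tendsto (fun n => eLpNorm (fun x => (deriv β (φ (k n) x) - deriv β (u x)) • G x)
        2 volume) atTop (𝓝 0) := by
      refine tendsto_eLpNorm_of_dominated (b := fun x => 2 * B * ‖G x‖)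
        (fun n => ((hdm n).sub hdu).smul hG.1) (hG.norm.const_mul _)
        (fun n => .of_forall fun x => ?_) ?_
      · rw [norm_smul]
        refine mul_le_mul_of_nonneg_right ((norm_sub_le _ _).trans ?_) (norm_nonneg _)
        linarith [hB (φ (k n) x), hB (u x), Real.norm_eq_abs (deriv β (φ (k n) x)),
          Real.norm_eq_abs (deriv β (u x))]
      · filter_upwards [hae] with x hx
        have := (((hβc.tendsto _).comp hx).sub_const (deriv β (u x))).smul_const (G x)
        simpa using this
    refine tendsto_of_tendsto_of_tendsto_of_le_of_le tendsto_const_nhds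
      (by simpa using h1.add h2) (fun _ => zero_le) fun n => ?_
    refine le_of_eq_of_le (eLpNorm_congr_ae (.of_forall fun x => ?_))
      (eLpNorm_add_le ((hdm n).smul ((hgm _).sub hG.1)) (((hdm n).sub hdu).smul hG.1) (by norm_num))
    simp only [Pi.sub_apply, Pi.add_apply, smul_sub, sub_smul]
    rw [gradient_comp_apply (hβd _) ((h.contDiff _).differentiable (by simp) _)]
    abel

/-! ### Hardy's inequality with a nonlinear weight -/

/-- The vector field `x / (η + |x|²)`. -/
noncomputable def hardyField (η : ℝ) (x : E d) : E d := (η + ‖x‖ ^ 2)⁻¹ • x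

lemma norm_hardyField {η : ℝ} (hη : 0 ≤ η) (x : E d) :
    ‖hardyField η x‖ = (η + ‖x‖ ^ 2)⁻¹ * ‖x‖ := by
  rw [hardyField, norm_smul, Real.norm_of_nonneg (by positivity)]

lemma norm_hardyField_le {η : ℝ} (hη : 0 < η) (x : E d) : ‖hardyField η x‖ ≤ 1 + η⁻¹ := by
  rw [norm_hardyField hη.le, inv_mul_le_iff₀ (by positivity)]
  have : (η + ‖x‖ ^ 2) * (1 + η⁻¹) = η + 1 + ‖x‖ ^ 2 + ‖x‖ ^ 2 * η⁻¹ := by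
    field_simp
    ring
  rw [this]
  have : 0 ≤ ‖x‖ ^ 2 * η⁻¹ := by positivity
  nlinarith [sq_nonneg (‖x‖ - 1)]

/-- Makes the field at the limiting parameter a dominating function when the regularisation is
removed. -/
lemma norm_hardyField_anti {η η' : ℝ} (hη : 0 ≤ η) (h : η ≤ η') (x : E d) :
    ‖hardyField η' x‖ ≤ ‖hardyField η x‖ := by
  by_cases hx : x = 0
  · simp [hardyField, hx]
  rw [norm_hardyField (hη.trans h), norm_hardyField hη]
  have : 0 < ‖x‖ := norm_pos_iff.2 hx
  gcongr

lemma contDiff_hardyField {η : ℝ} (hη : 0 < η) : ContDiff ℝ ∞ (hardyField η : E d → E d) := by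
  unfold hardyField
  have h : ContDiff ℝ ∞ fun x : E d => η + ‖x‖ ^ 2 := contDiff_const.add (contDiff_norm_sq ℝ)
  exact (h.inv fun x => by positivity).smul contDiff_id

lemma measurable_hardyField (η : ℝ) : Measurable (hardyField η : E d → E d) := by
  unfold hardyField
  fun_prop

lemma tendsto_hardyField {η : ℕ → ℝ} {η₀ : ℝ} (hη₀ : 0 ≤ η₀) (hη : Tendsto η atTop (𝓝 η₀))
    (x : E d) : Tendsto (fun n => hardyField (η n) x) atTop (𝓝 (hardyField η₀ x)) := by
  by_cases hx : x = 0
  · simp [hardyField, hx]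
  · refine Tendsto.smul_const (Tendsto.inv₀ (hη.add_const _) ?_) x
    have : 0 < ‖x‖ := norm_pos_iff.2 hx
    positivity

/-- The divergence of the vector field `x / (η + |x|²)`. -/
noncomputable def hardyDiv (η : ℝ) (x : E d) : ℝ :=
  d * (η + ‖x‖ ^ 2)⁻¹ - 2 * ‖x‖ ^ 2 * ((η + ‖x‖ ^ 2)⁻¹) ^ 2

/-- The difference of the two sides is `dη/(η+|x|²)² ≥ 0`. For `η = 0` it would vanish, so nothing
is lost in the Hardy constant. -/
lemma hardyDiv_ge {η : ℝ} (hη : 0 < η) (x : E d) :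
    ((d : ℝ) - 2) * ‖hardyField η x‖ ^ 2 ≤ hardyDiv η x := by
  rw [norm_hardyField hη.le, hardyDiv]
  have h : 0 < η + ‖x‖ ^ 2 := by positivity
  have e : (η + ‖x‖ ^ 2)⁻¹ = (η + ‖x‖ ^ 2) * ((η + ‖x‖ ^ 2)⁻¹) ^ 2 := by field_simp
  have h2 : 0 ≤ d * η * ((η + ‖x‖ ^ 2)⁻¹) ^ 2 := by positivity
  calc _ = ((d : ℝ) - 2) * ‖x‖ ^ 2 * ((η + ‖x‖ ^ 2)⁻¹) ^ 2 := by ring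
    _ ≤ d * ((η + ‖x‖ ^ 2) * ((η + ‖x‖ ^ 2)⁻¹) ^ 2)
        - 2 * ‖x‖ ^ 2 * ((η + ‖x‖ ^ 2)⁻¹) ^ 2 := by nlinarith
    _ = _ := by rw [← e]

lemma continuous_hardyDiv {η : ℝ} (hη : 0 < η) : Continuous (hardyDiv η : E d → ℝ) := by
  have : Continuous fun x : E d => (η + ‖x‖ ^ 2)⁻¹ :=
    Continuous.inv₀ (by fun_prop) fun x => by positivity
  unfold hardyDiv
  fun_prop

lemma fderiv_hardyField_apply {η : ℝ} (hη : 0 < η) (x : E d) (i : Fin d) :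
    fderiv ℝ (fun y : E d => hardyField η y i) x (EuclideanSpace.single i 1) =
      (η + ‖x‖ ^ 2)⁻¹ - 2 * x i ^ 2 * ((η + ‖x‖ ^ 2)⁻¹) ^ 2 := by
  have hne : η + ‖x‖ ^ 2 ≠ 0 := by positivity
  have h1 : HasFDerivAt (fun y : E d => η + ‖y‖ ^ 2) (2 • innerSL ℝ x) x :=
    (hasStrictFDerivAt_norm_sq x).hasFDerivAt.const_add η
  have h2 := (hasDerivAt_inv hne).comp_hasFDerivAt x h1
  have h3 : HasFDerivAt (fun y : E d => y i) (EuclideanSpace.proj i : E d →L[ℝ] ℝ) x :=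
    (EuclideanSpace.proj i : E d →L[ℝ] ℝ).hasFDerivAt
  have h4 := h2.mul h3
  have e : (fun y : E d => hardyField η y i) = ((fun z => z⁻¹) ∘ fun y : E d => η + ‖y‖ ^ 2) *
      fun y => y i := by
    ext y; simp [hardyField]
  rw [e, h4.fderiv]
  simp [EuclideanSpace.inner_single_right]
  ring

lemma integral_inner_hardyField_gradient {η : ℝ} (hη : 0 < η) {ψ : E d → ℝ}
    (hψ : ContDiff ℝ ∞ ψ) (hc : HasCompactSupport ψ) :
    ∫ x, ⟪hardyField η x, ∇ ψ x⟫ = -∫ x, ψ x * hardyDiv η x := by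
  have hsm : ∀ i, ContDiff ℝ ∞ fun y : E d => hardyField η y i := fun i =>
    (EuclideanSpace.proj i : E d →L[ℝ] ℝ).contDiff.comp (contDiff_hardyField hη)
  have hder : ∀ f : E d → ℝ, ContDiff ℝ ∞ f → ∀ v, Continuous fun x => fderiv ℝ f x v :=
    fun f hf v => (hf.continuous_fderiv (by simp)).clm_apply continuous_const
  have hcv : ∀ v : E d, HasCompactSupport fun x => fderiv ℝ ψ x v := fun v =>
    (hc.fderiv (𝕜 := ℝ)).comp_left (g := fun L : E d →L[ℝ] ℝ => L v) rfl
  have hi1 : ∀ i : Fin d, Integrable (fun x => hardyField η x i *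
      fderiv ℝ ψ x (EuclideanSpace.single i 1)) volume := fun i =>
    ((hsm i).continuous.mul (hder ψ hψ _)).integrable_of_hasCompactSupport (hcv _).mul_left
  have hi2 : ∀ i : Fin d, Integrable (fun x => fderiv ℝ (fun y : E d => hardyField η y i) x
      (EuclideanSpace.single i 1) * ψ x) volume := fun i =>
    ((hder _ (hsm i) _).mul hψ.continuous).integrable_of_hasCompactSupport hc.mul_left
  have e1 : ∀ x, ⟪hardyField η x, ∇ ψ x⟫ = ∑ i, hardyField η x i *
      fderiv ℝ ψ x (EuclideanSpace.single i 1) := fun x => by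
    rw [inner_gradient_right]
    conv_lhs => rw [← (EuclideanSpace.basisFun (Fin d) ℝ).sum_repr (hardyField η x)]
    simp
  have e2 : ∀ x, ψ x * hardyDiv η x = ∑ i, fderiv ℝ (fun y : E d => hardyField η y i) x
      (EuclideanSpace.single i 1) * ψ x := fun x => by
    simp_rw [fderiv_hardyField_apply hη, ← Finset.sum_mul, Finset.sum_sub_distrib,
      ← Finset.sum_mul, ← Finset.mul_sum, ← EuclideanSpace.real_norm_sq_eq, hardyDiv]
    simp
    ring
  simp_rw [e1, e2]
  rw [integral_finsetSum _ fun i _ => hi1 i, integral_finsetSum _ fun i _ => hi2 i,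
    ← Finset.sum_neg_distrib]
  refine Finset.sum_congr rfl fun i _ => ?_
  refine integral_mul_fderiv_eq_neg_fderiv_mul_of_integrable (hi2 i) (hi1 i) ?_
    (fun x _ => (hsm i).differentiable (by simp) x) (fun x _ => hψ.differentiable (by simp) x)
  exact ((hsm i).continuous.mul hψ.continuous).integrable_of_hasCompactSupport hc.mul_left

/-- A bounded nonnegative weight `ζ` together with the primitive `h` of `s ζ(s)`, such that
`s² ζ(s) ≤ 2 h(s)`. -/
structure HardyWeight (ζ h : ℝ → ℝ) (B : ℝ) (K : ℝ≥0) : Prop where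
  continuous : Continuous ζ
  nonneg : ∀ s, 0 ≤ ζ s
  le : ∀ s, ζ s ≤ B
  lipschitz : LipschitzWith K fun s => s * ζ s
  contDiff : ContDiff ℝ ∞ h
  map_zero : h 0 = 0
  hasDerivAt : ∀ s, HasDerivAt h (s * ζ s) s
  le_primitive : ∀ s, s * ζ s * s ≤ 2 * h s

namespace HardyWeight

variable {ζ h : ℝ → ℝ} {B : ℝ} {K : ℝ≥0}

lemma primitive_nonneg (w : HardyWeight ζ h B K) (s : ℝ) : 0 ≤ h s := by
  have h1 := w.le_primitive s
  have h2 := mul_nonneg (w.nonneg s) (sq_nonneg s)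
  nlinarith

lemma norm_mul_le (w : HardyWeight ζ h B K) (s : ℝ) : ‖s * ζ s‖ ≤ K * ‖s‖ := by
  simpa using w.lipschitz.dist_le_mul s 0

/-- By the chain rule `φ ζ(φ) ∇φ = ∇(h(φ))`, so integration by parts turns the right side into `∫
h(φ) div a`. Then `div a ≥ (d-2)|a|²` and `2h(s) ≥ s²ζ(s)` finish. -/
lemma hardy_of_contDiff (w : HardyWeight ζ h B K) (hd : 2 ≤ d) {η : ℝ} (hη : 0 < η)
    {φ : E d → ℝ} (hφ : ContDiff ℝ ∞ φ) (hc : HasCompactSupport φ) :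
    ((d : ℝ) - 2) / 2 * ∫ x, ⟪(φ x * ζ (φ x)) • hardyField η x, φ x • hardyField η x⟫ ≤
      -∫ x, ⟪(φ x * ζ (φ x)) • hardyField η x, ∇ φ x⟫ := by
  have hd' : (2 : ℝ) ≤ d := by exact_mod_cast hd
  have hhφ : ContDiff ℝ ∞ fun x => h (φ x) := w.contDiff.comp hφ
  have hhc : HasCompactSupport fun x => h (φ x) := hc.comp_left w.map_zero
  have e1 : ∫ x, ⟪(φ x * ζ (φ x)) • hardyField η x, ∇ φ x⟫ =
      ∫ x, ⟪hardyField η x, ∇ (fun y => h (φ y)) x⟫ := by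
    refine integral_congr_ae (.of_forall fun x => ?_)
    simp only []
    rw [gradient_comp_apply (w.hasDerivAt _).differentiableAt (hφ.differentiable (by simp) x),
      (w.hasDerivAt _).deriv, real_inner_smul_left, real_inner_smul_right]
  rw [e1, integral_inner_hardyField_gradient hη hhφ hhc, neg_neg, ← integral_const_mul]
  have hac := (contDiff_hardyField (d := d) hη).continuous
  have hζc : Continuous fun x => φ x * ζ (φ x) :=
    hφ.continuous.mul (w.continuous.comp hφ.continuous)
  refine integral_mono ?_ ?_ fun x => ?_
  · refine Continuous.integrable_of_hasCompactSupport
      (continuous_const.mul ((hζc.smul hac).inner (hφ.continuous.smul hac))) ?_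
    refine hc.mono fun x hx => ?_
    rw [Function.mem_support] at hx ⊢
    contrapose! hx
    simp [hx]
  · exact (hhφ.continuous.mul (continuous_hardyDiv hη)).integrable_of_hasCompactSupport
      hhc.mul_right
  · have h1 := w.le_primitive (φ x)
    have h2 := hardyDiv_ge hη x
    simp only [real_inner_smul_left, real_inner_smul_right, real_inner_self_eq_norm_sq]
    calc _ = (((d : ℝ) - 2) * ‖hardyField η x‖ ^ 2) * ((φ x * ζ (φ x) * φ x) / 2) := by ring
      _ ≤ (((d : ℝ) - 2) * ‖hardyField η x‖ ^ 2) * h (φ x) := by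
          refine mul_le_mul_of_nonneg_left (by linarith) ?_
          exact mul_nonneg (by linarith) (by positivity)
      _ ≤ hardyDiv η x * h (φ x) := mul_le_mul_of_nonneg_right h2 (w.primitive_nonneg _)
      _ = _ := mul_comm _ _

end HardyWeight

lemma memLp_smul_hardyField {η : ℝ} (hη : 0 < η) {f : E d → ℝ} (hf : MemLp f 2 volume) :
    MemLp (fun x => f x • hardyField η x) 2 volume := by
  refine MemLp.of_le_mul (c := 1 + η⁻¹) hf
    (hf.1.smul (measurable_hardyField η).aestronglyMeasurable) (.of_forall fun x => ?_)
  rw [norm_smul, mul_comm]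
  exact mul_le_mul_of_nonneg_right (norm_hardyField_le hη x) (norm_nonneg _)

namespace HardyWeight

variable {ζ h : ℝ → ℝ} {B : ℝ} {K : ℝ≥0} {u : E d → ℝ} {G : E d → E d} {φ : ℕ → E d → ℝ}

lemma memLp_mul (w : HardyWeight ζ h B K) (hu : MemLp u 2 volume) :
    MemLp (fun x => u x * ζ (u x)) 2 volume :=
  MemLp.of_le_mul (c := K) hu (hu.1.mul (w.continuous.comp_aestronglyMeasurable hu.1))
    (.of_forall fun _ => w.norm_mul_le _)

lemma hardy_of_pos (w : HardyWeight ζ h B K) (hd : 2 ≤ d) {η : ℝ} (hη : 0 < η)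
    (hu : MemLp u 2 volume) (hG : MemLp G 2 volume) (hφ : ApproxH1 u G φ) :
    ((d : ℝ) - 2) / 2 * ∫ x, ⟪(u x * ζ (u x)) • hardyField η x, u x • hardyField η x⟫ ≤
      -∫ x, ⟪(u x * ζ (u x)) • hardyField η x, G x⟫ := by
  have hφ2 : ∀ n, MemLp (φ n) 2 volume := fun n =>
    memLp_of_contDiff (hφ.contDiff n) (hφ.hasCompactSupport n) 2
  have h1 : Tendsto (fun n => eLpNorm ((fun x => (φ n x * ζ (φ n x)) • hardyField η x) -
      fun x => (u x * ζ (u x)) • hardyField η x) 2 volume) atTop (𝓝 0) := by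
    refine tendsto_eLpNorm_of_norm_le_mul ((1 + η⁻¹) * K) (fun n => .of_forall fun x => ?_)
      hφ.tendsto
    have hl := w.lipschitz.dist_le_mul (φ n x) (u x)
    rw [dist_eq_norm, dist_eq_norm] at hl
    simp only [Pi.sub_apply]
    rw [← sub_smul, norm_smul, mul_comm, mul_assoc]
    exact mul_le_mul (norm_hardyField_le hη x) hl (norm_nonneg _) (by positivity)
  have h2 : Tendsto (fun n => eLpNorm ((fun x => φ n x • hardyField η x) -
      fun x => u x • hardyField η x) 2 volume) atTop (𝓝 0) := by
    refine tendsto_eLpNorm_of_norm_le_mul (1 + η⁻¹) (fun n => .of_forall fun x => ?_)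
      hφ.tendsto
    simp only [Pi.sub_apply]
    rw [← sub_smul, norm_smul, mul_comm]
    exact mul_le_mul_of_nonneg_right (norm_hardyField_le hη x) (norm_nonneg _)
  have m1 := fun n => memLp_smul_hardyField hη (w.memLp_mul (hφ2 n))
  have m0 := memLp_smul_hardyField hη (w.memLp_mul hu)
  refine le_of_tendsto_of_tendsto' ((tendsto_integral_inner_of_eLpNorm m1
    (fun n => memLp_smul_hardyField hη (hφ2 n)) m0 (memLp_smul_hardyField hη hu) h1 h2).const_mul _)
    (tendsto_integral_inner_of_eLpNorm m1 (fun n => memLp_gradient_of_contDiff (hφ.contDiff n)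
      (hφ.hasCompactSupport n) 2) m0 hG h1 hφ.tendsto_grad).neg fun n =>
      w.hardy_of_contDiff hd hη (hφ.contDiff n) (hφ.hasCompactSupport n)

end HardyWeight

/-- The weight of the `L²` energy, for which the nonlinear inequality is the classical one. -/
lemma hardyWeight_one : HardyWeight (fun _ => 1) (fun s => s ^ 2 / 2) 1 1 where
  continuous := continuous_const
  nonneg _ := zero_le_one
  le _ := le_rfl
  lipschitz := by simp only [mul_one]; exact LipschitzWith.id
  contDiff := by fun_prop
  map_zero := by simp
  hasDerivAt s := by
    have := (hasDerivAt_pow 2 s).div_const 2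
    simpa using this
  le_primitive s := by nlinarith

lemma norm_le_div_of_mul_sq_le {H : Type*} [NormedAddCommGroup H] [InnerProductSpace ℝ H] {k : ℝ}
    (hk : 0 < k) {x y : H} (h : k * ‖x‖ ^ 2 ≤ -⟪x, y⟫) : ‖x‖ ≤ ‖y‖ / k := by
  have h2 := neg_le_of_abs_le (abs_real_inner_le_norm x y)
  rw [le_div_iff₀ hk]
  by_contra! hlt
  have h3 : 0 < ‖x‖ := by
    by_contra! h0
    rw [le_antisymm h0 (norm_nonneg _), zero_mul] at hlt
    exact absurd hlt (not_lt.2 (norm_nonneg _))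
  have h4 := mul_lt_mul_of_pos_left hlt h3
  nlinarith

/-- Hardy's inequality, qualitative form. -/
lemma ApproxH1.memLp_smul_hardyField_zero {u : E d → ℝ} {G : E d → E d} {φ : ℕ → E d → ℝ}
    (hd : 3 ≤ d) (hu : MemLp u 2 volume) (hG : MemLp G 2 volume) (hφ : ApproxH1 u G φ) :
    MemLp (fun x => u x • hardyField 0 x) 2 volume := by
  have hd' : (0 : ℝ) < ((d : ℝ) - 2) / 2 := by
    have : (3 : ℝ) ≤ d := by exact_mod_cast hd
    linarith
  set k : ℝ := ((d : ℝ) - 2) / 2 with hk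
  let η : ℕ → ℝ := fun n => 1 / ((n : ℝ) + 1)
  have hη : ∀ n, 0 < η n := fun n => by positivity
  have hηl : Tendsto η atTop (𝓝 0) := tendsto_one_div_add_atTop_nhds_zero_nat
  have m := fun n => memLp_smul_hardyField (hη n) hu
  -- Hardy's inequality for `η > 0`, where the left side is known to be finite, bounds the norm
  -- uniformly in `η`. Fatou's lemma then gives the case `η = 0`.
  have hbound : ∀ n, ‖(m n).toLp _‖ ≤ ‖hG.toLp G‖ / k := fun n => by
    have h1 := hardyWeight_one.hardy_of_pos (by omega) (hη n) hu hG hφ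
    simp only [mul_one] at h1
    have e1 : ∫ x, ⟪u x • hardyField (η n) x, u x • hardyField (η n) x⟫ =
        ‖(m n).toLp _‖ ^ 2 := by
      rw [← real_inner_self_eq_norm_sq, inner_toLp]
    have e2 : ∫ x, ⟪u x • hardyField (η n) x, G x⟫ = ⟪(m n).toLp _, hG.toLp G⟫ :=
      (inner_toLp (m n) hG).symm
    rw [e1, e2] at h1
    exact norm_le_div_of_mul_sq_le hd' h1
  have hbound' : ∀ n, eLpNorm (fun x => u x • hardyField (η n) x) 2 volume ≤
      ENNReal.ofReal (‖hG.toLp G‖ / k) := fun n => by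
    have := hbound n
    rw [Lp.norm_toLp] at this
    exact ENNReal.le_ofReal_iff_toReal_le (m n).2.ne (by positivity) |>.2 this
  refine ⟨hu.1.smul (measurable_hardyField 0).aestronglyMeasurable, ?_⟩
  refine lt_of_le_of_lt ?_ (ENNReal.ofReal_lt_top (r := ‖hG.toLp G‖ / k))
  refine (Lp.eLpNorm_lim_le_liminf_eLpNorm (fun n => (m n).1) _
    (.of_forall fun x => (tendsto_hardyField le_rfl hηl x).const_smul (u x))).trans ?_
  exact liminf_le_of_frequently_le' (Frequently.of_forall hbound')

lemma ApproxH1.memLp_smul_hardyField {u : E d → ℝ} {G : E d → E d} {φ : ℕ → E d → ℝ}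
    (hd : 3 ≤ d) {η : ℝ} (hη : 0 ≤ η) (hu : MemLp u 2 volume) (hG : MemLp G 2 volume)
    (hφ : ApproxH1 u G φ) : MemLp (fun x => u x • hardyField η x) 2 volume := by
  rcases hη.eq_or_lt with rfl | h
  · exact hφ.memLp_smul_hardyField_zero hd hu hG
  · exact FokkerPlanck.memLp_smul_hardyField h hu

lemma tendsto_smul_hardyField {f : E d → ℝ} (hf : AEStronglyMeasurable f volume) {η₀ : ℝ}
    (hη₀ : 0 ≤ η₀) (h0 : MemLp (fun x => f x • hardyField η₀ x) 2 volume) {η : ℕ → ℝ}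
    (hη : ∀ n, η₀ ≤ η n) (hηl : Tendsto η atTop (𝓝 η₀)) :
    Tendsto (fun n => eLpNorm ((fun x => f x • hardyField (η n) x) -
      fun x => f x • hardyField η₀ x) 2 volume) atTop (𝓝 0) := by
  refine tendsto_eLpNorm_of_dominated (b := fun x => 2 * ‖f x • hardyField η₀ x‖)
    (fun n => (hf.smul (measurable_hardyField _).aestronglyMeasurable).sub h0.1)
    (h0.norm.const_mul 2) (fun n => .of_forall fun x => ?_) (.of_forall fun x => ?_)
  · refine (norm_sub_le _ _).trans ?_
    rw [two_mul]
    refine add_le_add ?_ le_rfl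
    rw [norm_smul, norm_smul]
    exact mul_le_mul_of_nonneg_left (norm_hardyField_anti hη₀ (hη n) x) (norm_nonneg _)
  · have := ((tendsto_hardyField hη₀ hηl x).const_smul (f x)).sub_const (f x • hardyField η₀ x)
    simpa using this

namespace HardyWeight

variable {ζ h : ℝ → ℝ} {B : ℝ} {K : ℝ≥0} {u : E d → ℝ} {G : E d → E d} {φ : ℕ → E d → ℝ}

lemma memLp_mul_smul_hardyField (w : HardyWeight ζ h B K) (hu : MemLp u 2 volume) {η : ℝ}
    (m : MemLp (fun x => u x • hardyField η x) 2 volume) :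
    MemLp (fun x => (u x * ζ (u x)) • hardyField η x) 2 volume := by
  refine MemLp.of_le_mul (c := K) m ((w.memLp_mul hu).1.smul
    (measurable_hardyField η).aestronglyMeasurable) (.of_forall fun x => ?_)
  rw [norm_smul, norm_smul, ← mul_assoc]
  exact mul_le_mul_of_nonneg_right (w.norm_mul_le _) (norm_nonneg _)

/-- A nonlinear form of Hardy's inequality. -/
lemma hardy (w : HardyWeight ζ h B K) (hd : 3 ≤ d) {η : ℝ} (hη : 0 ≤ η)
    (hu : MemLp u 2 volume) (hG : MemLp G 2 volume) (hφ : ApproxH1 u G φ) :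
    ((d : ℝ) - 2) / 2 * ∫ x, ⟪(u x * ζ (u x)) • hardyField η x, u x • hardyField η x⟫ ≤
      -∫ x, ⟪(u x * ζ (u x)) • hardyField η x, G x⟫ := by
  rcases hη.eq_or_lt with rfl | hη
  swap
  · exact w.hardy_of_pos (by omega) hη hu hG hφ
  let η : ℕ → ℝ := fun n => 1 / ((n : ℝ) + 1)
  have hη : ∀ n, 0 < η n := fun n => by positivity
  have hηl : Tendsto η atTop (𝓝 0) := tendsto_one_div_add_atTop_nhds_zero_nat
  have m0 := hφ.memLp_smul_hardyField_zero hd hu hG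
  have m1 := w.memLp_mul_smul_hardyField hu m0
  have l0 := tendsto_smul_hardyField hu.1 le_rfl m0 (fun n => (hη n).le) hηl
  have l1 := tendsto_smul_hardyField (w.memLp_mul hu).1 le_rfl m1 (fun n => (hη n).le) hηl
  have mf := fun n => memLp_smul_hardyField (hη n) (w.memLp_mul hu)
  refine le_of_tendsto_of_tendsto' ((tendsto_integral_inner_of_eLpNorm mf
    (fun n => memLp_smul_hardyField (hη n) hu) m1 m0 l1 l0).const_mul _)
    (tendsto_integral_inner_of_eLpNorm mf (fun _ => hG) m1 hG l1 (by simp)).neg fun n =>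
      w.hardy_of_pos (by omega) (hη n) hu hG hφ

lemma memLp_smul (w : HardyWeight ζ h B K) (hu : MemLp u 2 volume) (hG : MemLp G 2 volume) :
    MemLp (fun x => ζ (u x) • G x) 2 volume := by
  refine MemLp.of_le_mul (c := B) hG ((w.continuous.comp_aestronglyMeasurable hu.1).smul hG.1)
    (.of_forall fun x => ?_)
  rw [norm_smul, Real.norm_of_nonneg (w.nonneg _)]
  exact mul_le_mul_of_nonneg_right (w.le _) (norm_nonneg _)

/-- The drift does not destroy the dissipation. -/
lemma dissipation (w : HardyWeight ζ h B K) (hd : 3 ≤ d) {γ : ℝ} {η : ℝ} (hη : 0 ≤ η)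
    (hu : MemLp u 2 volume) (hG : MemLp G 2 volume) (hφ : ApproxH1 u G φ) :
    min 1 (1 - 2 * γ / ((d : ℝ) - 2)) * ∫ x, ζ (u x) * ‖G x‖ ^ 2 ≤
      ∫ x, ⟪G x + γ • u x • hardyField η x, ζ (u x) • G x⟫ := by
  have hd' : (0 : ℝ) < (d : ℝ) - 2 := by
    have : (3 : ℝ) ≤ d := by exact_mod_cast hd
    linarith
  have m := hφ.memLp_smul_hardyField hd hη hu hG
  have mf := w.memLp_mul_smul_hardyField hu m
  have mG := w.memLp_smul hu hG
  set S := ∫ x, ⟪(u x * ζ (u x)) • hardyField η x, u x • hardyField η x⟫ with hS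
  set I := ∫ x, ⟪(u x * ζ (u x)) • hardyField η x, G x⟫ with hI
  set X := ∫ x, ζ (u x) * ‖G x‖ ^ 2 with hX
  have hX' : X = ∫ x, ⟪ζ (u x) • G x, G x⟫ := by
    refine integral_congr_ae (.of_forall fun x => ?_)
    simp only [real_inner_smul_left, real_inner_self_eq_norm_sq]
  have i1 : Integrable (fun x => ⟪ζ (u x) • G x, G x⟫) volume := integrable_inner_of_memLp mG hG
  have i2 : Integrable (fun x => ⟪(u x * ζ (u x)) • hardyField η x, G x⟫) volume :=
    integrable_inner_of_memLp mf hG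
  have i3 : Integrable (fun x => ⟪(u x * ζ (u x)) • hardyField η x, u x • hardyField η x⟫) volume :=
    integrable_inner_of_memLp mf m
  have hSI : ((d : ℝ) - 2) / 2 * S ≤ -I := w.hardy hd hη hu hG hφ
  have hS0 : 0 ≤ S := integral_nonneg fun x => by
    simp only [real_inner_smul_left, real_inner_smul_right, real_inner_self_eq_norm_sq, Pi.zero_apply]
    have := w.nonneg (u x)
    nlinarith [mul_nonneg (mul_nonneg this (sq_nonneg (u x))) (sq_nonneg ‖hardyField η x‖)]
  have hX0 : 0 ≤ X := integral_nonneg fun x => mul_nonneg (w.nonneg _) (sq_nonneg _)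
  set l : ℝ := ((d : ℝ) - 2) / 2 with hl
  have hl0 : 0 < l := by positivity
  have i12 : Integrable (fun x => ⟪ζ (u x) • G x, G x⟫ +
      2 * l * ⟪(u x * ζ (u x)) • hardyField η x, G x⟫) volume := i1.add (i2.const_mul _)
  -- Expansion of `∫ ζ(u) |G + l u a|² ≥ 0` with `l = (d-2)/2`. Combined with `l S ≤ -I` it gives
  -- `-I ≤ X/l`, the sharp bound on the cross term.
  have hsq : 0 ≤ X + 2 * l * I + l ^ 2 * S := by
    rw [hX', hI, hS, ← integral_const_mul, ← integral_const_mul, ← integral_add i1 (i2.const_mul _),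
      ← integral_add i12 (i3.const_mul _)]
    refine integral_nonneg fun x => ?_
    have e : ⟪ζ (u x) • G x, G x⟫ + 2 * l * ⟪(u x * ζ (u x)) • hardyField η x, G x⟫ +
        l ^ 2 * ⟪(u x * ζ (u x)) • hardyField η x, u x • hardyField η x⟫ =
        ζ (u x) * ‖G x + (l * u x) • hardyField η x‖ ^ 2 := by
      rw [norm_add_sq_real, norm_smul, mul_pow, Real.norm_eq_abs, sq_abs]
      simp only [real_inner_smul_left, real_inner_smul_right, real_inner_self_eq_norm_sq,
        real_inner_comm (G x) (hardyField η x)]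
      ring
    simp only [Pi.zero_apply, e]
    exact mul_nonneg (w.nonneg _) (sq_nonneg _)
  have hIX : l * (-I) ≤ X := by nlinarith
  have hI0 : 0 ≤ -I := le_trans (by positivity) hSI
  have e : ∫ x, ⟪G x + γ • u x • hardyField η x, ζ (u x) • G x⟫ = X + γ * I := by
    rw [hX', hI, ← integral_const_mul, ← integral_add i1 (i2.const_mul _)]
    refine integral_congr_ae (.of_forall fun x => ?_)
    simp only [inner_add_left, real_inner_smul_left, real_inner_smul_right]
    ring
  rw [e]
  -- For `γ ≤ 0` the cross term helps because `I ≤ 0`. For `γ ≥ 0` it consumes at most the fraction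
  -- `γ/l = 2γ/(d-2)` of `X`.
  rcases le_total γ 0 with hγ | hγ
  · have h1 : min 1 (1 - 2 * γ / ((d : ℝ) - 2)) * X ≤ 1 * X :=
      mul_le_mul_of_nonneg_right (min_le_left _ _) hX0
    nlinarith
  · have h1 : min 1 (1 - 2 * γ / ((d : ℝ) - 2)) * X ≤ (1 - 2 * γ / ((d : ℝ) - 2)) * X :=
      mul_le_mul_of_nonneg_right (min_le_right _ _) hX0
    have h2 : 2 * γ / ((d : ℝ) - 2) = γ / l := by rw [hl]; field_simp
    rw [h2] at h1 ⊢
    have h3 : γ * (-I) ≤ γ / l * X := by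
      rw [div_mul_eq_mul_div, le_div_iff₀ hl0]
      nlinarith
    linarith

end HardyWeight

/-- A smooth regularisation of the absolute value. -/
noncomputable def smoothAbs (ε s : ℝ) : ℝ := √(s ^ 2 + ε ^ 2) - ε

/-! ### The convex regularisation of the absolute value -/

section SmoothAbs

variable {ε : ℝ}

lemma sqrt_sq_add_sq_pos (hε : 0 < ε) (s : ℝ) : 0 < √(s ^ 2 + ε ^ 2) :=
  Real.sqrt_pos.2 (add_pos_of_nonneg_of_pos (sq_nonneg s) (pow_pos hε 2))

lemma le_sqrt_sq_add_sq (ε s : ℝ) : ε ≤ √(s ^ 2 + ε ^ 2) :=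
  Real.le_sqrt_of_sq_le (by nlinarith [sq_nonneg s])

lemma abs_le_sqrt_sq_add_sq (ε s : ℝ) : |s| ≤ √(s ^ 2 + ε ^ 2) :=
  Real.abs_le_sqrt (by nlinarith [sq_nonneg ε])

lemma contDiff_sqrt_sq_add_sq (hε : 0 < ε) : ContDiff ℝ ∞ fun s : ℝ => √(s ^ 2 + ε ^ 2) :=
  ContDiff.sqrt (by fun_prop) fun _ => by positivity

lemma hasDerivAt_sqrt_sq_add_sq (hε : 0 < ε) (s : ℝ) :
    HasDerivAt (fun s : ℝ => √(s ^ 2 + ε ^ 2)) (s * (√(s ^ 2 + ε ^ 2))⁻¹) s := by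
  have h := ((hasDerivAt_pow 2 s).add_const (ε ^ 2)).sqrt (by positivity)
  refine h.congr_deriv ?_
  have := (sqrt_sq_add_sq_pos hε s).ne'
  field_simp
  simp [mul_comm]

lemma hasDerivAt_inv_sqrt_sq_add_sq (hε : 0 < ε) (s : ℝ) :
    HasDerivAt (fun s : ℝ => (√(s ^ 2 + ε ^ 2))⁻¹) (-(s * (√(s ^ 2 + ε ^ 2))⁻¹ ^ 3)) s := by
  have h := (hasDerivAt_sqrt_sq_add_sq hε s).inv (sqrt_sq_add_sq_pos hε s).ne'
  refine h.congr_deriv ?_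
  have := (sqrt_sq_add_sq_pos hε s).ne'
  field_simp

lemma contDiff_smoothAbs_deriv (hε : 0 < ε) :
    ContDiff ℝ ∞ fun s : ℝ => s * (√(s ^ 2 + ε ^ 2))⁻¹ :=
  contDiff_id.mul ((contDiff_sqrt_sq_add_sq hε).inv fun s => (sqrt_sq_add_sq_pos hε s).ne')

lemma hasDerivAt_smoothAbs_deriv (hε : 0 < ε) (s : ℝ) :
    HasDerivAt (fun s : ℝ => s * (√(s ^ 2 + ε ^ 2))⁻¹) (ε ^ 2 * (√(s ^ 2 + ε ^ 2))⁻¹ ^ 3) s := by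
  have h := (hasDerivAt_id s).mul (hasDerivAt_inv_sqrt_sq_add_sq hε s)
  refine h.congr_deriv ?_
  have h1 := (sqrt_sq_add_sq_pos hε s).ne'
  have h2 := Real.sq_sqrt (by positivity : 0 ≤ s ^ 2 + ε ^ 2)
  have h3 : (√(s ^ 2 + ε ^ 2))⁻¹ = √(s ^ 2 + ε ^ 2) ^ 2 * (√(s ^ 2 + ε ^ 2))⁻¹ ^ 3 := by field_simp
  simp only [id, one_mul]
  nth_rewrite 1 [h3]
  rw [h2]
  ring

/-- The weight is the second derivative of `smoothAbs ε`, so the `L¹` estimate falls under the same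
Hardy argument as the energy. -/
lemma hardyWeight_smoothAbs (hε : 0 < ε) :
    HardyWeight (fun s => ε ^ 2 * (√(s ^ 2 + ε ^ 2))⁻¹ ^ 3)
      (fun s => ε - ε ^ 2 * (√(s ^ 2 + ε ^ 2))⁻¹) ε⁻¹ (Real.toNNReal (4 * ε⁻¹)) where
  continuous := continuous_const.mul
    (((contDiff_sqrt_sq_add_sq hε).inv fun s => (sqrt_sq_add_sq_pos hε s).ne').continuous.pow 3)
  nonneg s := by positivity
  le s := by
    have h1 : (√(s ^ 2 + ε ^ 2))⁻¹ ≤ ε⁻¹ := inv_anti₀ hε (le_sqrt_sq_add_sq ε s)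
    calc ε ^ 2 * (√(s ^ 2 + ε ^ 2))⁻¹ ^ 3 ≤ ε ^ 2 * ε⁻¹ ^ 3 := by gcongr
      _ = ε⁻¹ := by field_simp
  lipschitz := by
    have hder : ∀ s : ℝ, HasDerivAt (fun s : ℝ => s * (ε ^ 2 * (√(s ^ 2 + ε ^ 2))⁻¹ ^ 3))
        (1 * (ε ^ 2 * (√(s ^ 2 + ε ^ 2))⁻¹ ^ 3) + s * (ε ^ 2 * (3 * (√(s ^ 2 + ε ^ 2))⁻¹ ^ 2 *
          -(s * (√(s ^ 2 + ε ^ 2))⁻¹ ^ 3)))) s := fun s => by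
      have := (((hasDerivAt_inv_sqrt_sq_add_sq hε s).pow 3).const_mul (ε ^ 2))
      exact (hasDerivAt_id s).mul (by simpa using this)
    refine lipschitzWith_of_nnnorm_deriv_le (fun s => (hder s).differentiableAt) fun s => ?_
    rw [(hder s).deriv, ← NNReal.coe_le_coe, coe_nnnorm]
    rw [Real.coe_toNNReal _ (by positivity)]
    set p := (√(s ^ 2 + ε ^ 2))⁻¹ with hp
    have hq := sqrt_sq_add_sq_pos hε s
    have hp0 : 0 < p := inv_pos.2 hq
    have hpε : p ≤ ε⁻¹ := inv_anti₀ hε (le_sqrt_sq_add_sq ε s)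
    have hpq : (s ^ 2 + ε ^ 2) * p ^ 2 = 1 := by
      rw [hp, inv_pow, Real.sq_sqrt (by positivity)]
      exact mul_inv_cancel₀ (by positivity)
    have h1 : ε ^ 2 * p ^ 2 ≤ 1 := by nlinarith [mul_nonneg (sq_nonneg s) (sq_nonneg p)]
    have h2 : s ^ 2 * p ^ 2 ≤ 1 := by nlinarith [mul_nonneg (sq_nonneg ε) (sq_nonneg p)]
    have h10 : 0 ≤ ε ^ 2 * p ^ 2 := by positivity
    have h20 : 0 ≤ s ^ 2 * p ^ 2 := by positivity
    have e : 1 * (ε ^ 2 * p ^ 3) + s * (ε ^ 2 * (3 * p ^ 2 * -(s * p ^ 3))) =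
        (ε ^ 2 * p ^ 2) * (1 - 3 * (s ^ 2 * p ^ 2)) * p := by ring
    rw [e, norm_mul, Real.norm_of_nonneg hp0.le]
    refine mul_le_mul ?_ hpε hp0.le (by norm_num)
    rw [Real.norm_eq_abs, abs_le]
    constructor <;> nlinarith [mul_nonneg h10 h20, mul_le_mul h1 h2 h20 zero_le_one]
  contDiff := contDiff_const.sub (contDiff_const.mul
    ((contDiff_sqrt_sq_add_sq hε).inv fun s => (sqrt_sq_add_sq_pos hε s).ne'))
  map_zero := by
    have : √(0 ^ 2 + ε ^ 2) = ε := by rw [zero_pow two_ne_zero, zero_add, Real.sqrt_sq hε.le]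
    rw [this]
    field_simp
    simp
  hasDerivAt s := by
    refine (((hasDerivAt_inv_sqrt_sq_add_sq hε s).const_mul (ε ^ 2)).const_sub ε).congr_deriv ?_
    ring
  le_primitive s := by
    set q := √(s ^ 2 + ε ^ 2) with hq
    have hq0 : 0 < q := sqrt_sq_add_sq_pos hε s
    have hqe : ε ≤ q := le_sqrt_sq_add_sq ε s
    have hq2 : q ^ 2 = s ^ 2 + ε ^ 2 := Real.sq_sqrt (by positivity)
    -- With `q = √(s²+ε²) ≥ ε`, this factorisation exhibits `2h - s²ζ` as a product of nonnegative
    -- factors.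
    have e : 2 * (ε - ε ^ 2 * q⁻¹) - s * (ε ^ 2 * q⁻¹ ^ 3) * s =
        ε * (q - ε) * (2 * q ^ 2 - ε * (q + ε)) * q⁻¹ ^ 3 := by
      have : s ^ 2 = q ^ 2 - ε ^ 2 := by linarith
      field_simp
      rw [this]
      ring
    have h1 : 0 ≤ 2 * q ^ 2 - ε * (q + ε) := by nlinarith
    have h2 : 0 ≤ ε * (q - ε) * (2 * q ^ 2 - ε * (q + ε)) * q⁻¹ ^ 3 :=
      mul_nonneg (mul_nonneg (mul_nonneg hε.le (by linarith)) h1) (by positivity)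
    linarith

lemma smoothAbs_nonneg (ε s : ℝ) : 0 ≤ smoothAbs ε s :=
  sub_nonneg.2 (le_sqrt_sq_add_sq ε s)

lemma smoothAbs_zero (hε : 0 < ε) : smoothAbs ε 0 = 0 := by
  simp [smoothAbs, Real.sqrt_sq hε.le]

lemma smoothAbs_le_abs (hε : 0 < ε) (s : ℝ) : smoothAbs ε s ≤ |s| := by
  rw [smoothAbs, sub_le_iff_le_add, ← sq_abs]
  refine Real.sqrt_le_iff.2 ⟨by positivity, ?_⟩
  nlinarith [mul_nonneg (abs_nonneg s) hε.le]

lemma abs_sub_le_smoothAbs (s : ℝ) : |s| - ε ≤ smoothAbs ε s :=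
  sub_le_sub_right (abs_le_sqrt_sq_add_sq ε s) ε

lemma continuous_smoothAbs (ε : ℝ) : Continuous (smoothAbs ε) := by
  unfold smoothAbs
  fun_prop

/-- A difference of square roots is the difference of the radicands over the sum of the roots, and
that sum is at least `2ε`. -/
lemma abs_smoothAbs_sub_le (hε : 0 < ε) (a b : ℝ) :
    |smoothAbs ε a - smoothAbs ε b| ≤ (2 * ε)⁻¹ * (|a - b| * |a + b|) := by
  have ha := le_sqrt_sq_add_sq ε a
  have hb := le_sqrt_sq_add_sq ε b
  have ha2 := Real.sq_sqrt (by positivity : 0 ≤ a ^ 2 + ε ^ 2)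
  have hb2 := Real.sq_sqrt (by positivity : 0 ≤ b ^ 2 + ε ^ 2)
  have e : |smoothAbs ε a - smoothAbs ε b| * (√(a ^ 2 + ε ^ 2) + √(b ^ 2 + ε ^ 2)) =
      |a - b| * |a + b| := by
    rw [← abs_of_pos (by linarith : 0 < √(a ^ 2 + ε ^ 2) + √(b ^ 2 + ε ^ 2)), ← abs_mul, ← abs_mul]
    congr 1
    rw [smoothAbs, smoothAbs]
    nlinarith
  rw [← e, inv_mul_eq_div, le_div_iff₀ (by positivity)]
  exact mul_le_mul_of_nonneg_left (by linarith) (abs_nonneg _)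

/-- The tangent line inequality of a convex function, here Cauchy–Schwarz for the vectors `(a, ε)`
and `(b, ε)`. -/
lemma smoothAbs_sub_le (hε : 0 < ε) (a b : ℝ) :
    smoothAbs ε b - smoothAbs ε a ≤ (b * (√(b ^ 2 + ε ^ 2))⁻¹) * (b - a) := by
  have hb := sqrt_sq_add_sq_pos hε b
  have hb2 := Real.sq_sqrt (by positivity : 0 ≤ b ^ 2 + ε ^ 2)
  have h1 : a * b + ε ^ 2 ≤ √(a ^ 2 + ε ^ 2) * √(b ^ 2 + ε ^ 2) := by
    rw [← Real.sqrt_mul (by positivity)]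
    exact Real.le_sqrt_of_sq_le (by nlinarith [sq_nonneg (ε * (a - b))])
  have e : (b * (√(b ^ 2 + ε ^ 2))⁻¹) * (b - a) - (smoothAbs ε b - smoothAbs ε a) =
      (√(a ^ 2 + ε ^ 2) * √(b ^ 2 + ε ^ 2) - (a * b + ε ^ 2)) * (√(b ^ 2 + ε ^ 2))⁻¹ := by
    rw [smoothAbs, smoothAbs]
    field_simp
    nlinarith
  have : 0 ≤ (√(a ^ 2 + ε ^ 2) * √(b ^ 2 + ε ^ 2) - (a * b + ε ^ 2)) * (√(b ^ 2 + ε ^ 2))⁻¹ :=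
    mul_nonneg (by linarith) (by positivity)
  linarith

end SmoothAbs

/-! ### Sobolev's inequality and the optimal Nash constant -/

lemma eLpNorm_gradient (f : E d → ℝ) (p : ℝ≥0∞) :
    eLpNorm (∇ f) p volume = eLpNorm (fderiv ℝ f) p volume :=
  eLpNorm_congr_norm_ae (.of_forall fun x => norm_gradient f x)

/-- The Sobolev exponent `2d/(d-2)`. -/
noncomputable def sobolevExponent (d : ℕ) : ℝ≥0 := Real.toNNReal (2 * d / ((d : ℝ) - 2))

lemma coe_sobolevExponent (hd : 3 ≤ d) : (sobolevExponent d : ℝ) = 2 * d / ((d : ℝ) - 2) := by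
  have : (3 : ℝ) ≤ d := by exact_mod_cast hd
  exact Real.coe_toNNReal _ (div_nonneg (by positivity) (by linarith))

/-- Sobolev's inequality in `H¹`. -/
lemma exists_eLpNorm_sobolevExponent_le (hd : 3 ≤ d) :
    ∃ C : ℝ≥0, ∀ (u : E d → ℝ) (G : E d → E d) (φ : ℕ → E d → ℝ), MemLp u 2 volume →
      MemLp G 2 volume → ApproxH1 u G φ →
      eLpNorm u (sobolevExponent d) volume ≤ C * eLpNorm G 2 volume := by
  have hd' : (3 : ℝ) ≤ d := by exact_mod_cast hd
  refine ⟨eLpNormLESNormFDerivOfEqInnerConst (volume : Measure (E d)) ((2 : ℝ≥0) : ℝ),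
    fun u G φ hu hG hφ => ?_⟩
  set C := eLpNormLESNormFDerivOfEqInnerConst (volume : Measure (E d)) ((2 : ℝ≥0) : ℝ)
  have hφm : ∀ n, AEStronglyMeasurable (φ n) volume := fun n =>
    (hφ.contDiff n).continuous.aestronglyMeasurable
  obtain ⟨k, hk, hae⟩ := (tendstoInMeasure_of_tendsto_eLpNorm (by norm_num) hφm hu.1
    hφ.tendsto).exists_seq_tendsto_ae
  have hle : ∀ n, eLpNorm (φ (k n)) (sobolevExponent d) volume ≤
      C * (eLpNorm G 2 volume + eLpNorm (∇ (φ (k n)) - G) 2 volume) := fun n => by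
    have h1 := eLpNorm_le_eLpNorm_fderiv_of_eq_inner (volume : Measure (E d)) (u := φ (k n))
      ((hφ.contDiff (k n)).of_le (by simp)) (hφ.hasCompactSupport (k n)) (p := 2)
      (p' := sobolevExponent d) (by norm_num) (by simp; omega) (by
        rw [coe_sobolevExponent hd]
        have : (d : ℝ) - 2 ≠ 0 := by linarith
        simp
        field_simp)
    refine h1.trans ?_
    gcongr
    rw [ENNReal.coe_ofNat, ← eLpNorm_gradient]
    have e : ∇ (φ (k n)) = G + (∇ (φ (k n)) - G) := by abel
    conv_lhs => rw [e]
    exact eLpNorm_add_le hG.1 ((continuous_gradient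
      ((hφ.contDiff _).of_le (by simp))).aestronglyMeasurable.sub hG.1) (by norm_num)
  have hlim : Tendsto (fun n => (C : ℝ≥0∞) * (eLpNorm G 2 volume +
      eLpNorm (∇ (φ (k n)) - G) 2 volume)) atTop (𝓝 (C * eLpNorm G 2 volume)) := by
    refine ENNReal.Tendsto.const_mul ?_ (Or.inr ENNReal.coe_ne_top)
    simpa using (hφ.tendsto_grad.comp hk.tendsto_atTop).const_add (eLpNorm G 2 volume)
  calc eLpNorm u (sobolevExponent d) volume
      ≤ liminf (fun n => eLpNorm (φ (k n)) (sobolevExponent d) volume) atTop :=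
        Lp.eLpNorm_lim_le_liminf_eLpNorm (fun n => hφm _) _ hae
    _ ≤ liminf (fun n => (C : ℝ≥0∞) * (eLpNorm G 2 volume +
          eLpNorm (∇ (φ (k n)) - G) 2 volume)) atTop := liminf_le_liminf (.of_forall hle)
    _ = _ := hlim.liminf_eq

/-- Hölder's inequality for `|u|² = |u|^(4/(d+2)) (|u|^p)^((d-2)/(d+2))` with `p = 2d/(d-2)`, raised
to the power `(d+2)/d`. -/
lemma eLpNorm_two_rpow_le (hd : 3 ≤ d) {α : Type*} [MeasurableSpace α] {μ : Measure α} {u : α → ℝ}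
    (hu : AEStronglyMeasurable u μ) :
    eLpNorm u 2 μ ^ (2 + 4 / (d : ℝ)) ≤
      eLpNorm u 1 μ ^ (4 / (d : ℝ)) * eLpNorm u (sobolevExponent d) μ ^ (2 : ℝ) := by
  have hd' : (3 : ℝ) ≤ d := by exact_mod_cast hd
  have hd2 : (0 : ℝ) < (d : ℝ) - 2 := by linarith
  have hp : (sobolevExponent d : ℝ) = 2 * d / ((d : ℝ) - 2) := coe_sobolevExponent hd
  have hp0 : 0 < (sobolevExponent d : ℝ) := by rw [hp]; positivity
  have hp0' : sobolevExponent d ≠ 0 := fun h => by simp [h] at hp0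
  set p := (sobolevExponent d : ℝ)
  have hH := ENNReal.lintegral_mul_norm_pow_le (μ := μ) (f := fun x => ‖u x‖ₑ)
    (g := fun x => ‖u x‖ₑ ^ p) hu.enorm (hu.enorm.pow_const p) (p := 4 / ((d : ℝ) + 2))
    (q := ((d : ℝ) - 2) / ((d : ℝ) + 2)) (by positivity) (by positivity) (by field_simp; ring)
  have e1 : ∀ x, ‖u x‖ₑ ^ (4 / ((d : ℝ) + 2)) * (‖u x‖ₑ ^ p) ^ (((d : ℝ) - 2) / ((d : ℝ) + 2)) =
      ‖u x‖ₑ ^ (2 : ℝ) := fun x => by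
    rw [← ENNReal.rpow_mul, ← ENNReal.rpow_add_of_nonneg _ _ (by positivity) (by positivity), hp]
    congr 1
    field_simp
    ring
  simp_rw [e1] at hH
  have e2 : ∫⁻ x, ‖u x‖ₑ ^ (2 : ℝ) ∂μ = eLpNorm u 2 μ ^ (2 : ℝ) := by
    have := eLpNorm_nnreal_pow_eq_lintegral (μ := μ) (f := u) (p := 2) (by norm_num)
    simpa using this.symm
  have e3 : ∫⁻ x, ‖u x‖ₑ ^ p ∂μ = eLpNorm u (sobolevExponent d) μ ^ p :=
    (eLpNorm_nnreal_pow_eq_lintegral hp0').symm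
  rw [e2, e3, ← eLpNorm_one_eq_lintegral_enorm] at hH
  have hH2 := ENNReal.rpow_le_rpow hH (z := ((d : ℝ) + 2) / d) (by positivity)
  rw [ENNReal.mul_rpow_of_nonneg _ _ (by positivity)] at hH2
  simp only [← ENNReal.rpow_mul] at hH2
  convert hH2 using 2
  · field_simp
    ring
  · congr 1
    field_simp
  · rw [hp]
    congr 1
    field_simp

lemma nashConstants_nonempty (hd : 3 ≤ d) : ∃ C ∈ nashConstants d, 0 ≤ C := by
  obtain ⟨C, hC⟩ := exists_eLpNorm_sobolevExponent_le hd
  refine ⟨(C : ℝ) ^ 2, fun u G h1 h2 hG hw => ?_, by positivity⟩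
  obtain ⟨φ, hφ⟩ := hw.exists_approx h2 hG
  have hS := hC u G φ h2 hG hφ
  have hI := (eLpNorm_two_rpow_le hd h2.1).trans
    (mul_le_mul_right (ENNReal.rpow_le_rpow hS (by norm_num : (0 : ℝ) ≤ 2)) _)
  have hfin : eLpNorm u 1 volume ^ (4 / (d : ℝ)) * (C * eLpNorm G 2 volume) ^ (2 : ℝ) ≠ ⊤ :=
    ENNReal.mul_ne_top (ENNReal.rpow_ne_top_of_nonneg (by positivity) h1.2.ne)
      (ENNReal.rpow_ne_top_of_nonneg (by norm_num) (ENNReal.mul_ne_top ENNReal.coe_ne_top hG.2.ne))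
  have hR := ENNReal.toReal_mono hfin hI
  rw [ENNReal.toReal_mul, ← ENNReal.toReal_rpow, ← ENNReal.toReal_rpow, ← ENNReal.toReal_rpow,
    ENNReal.toReal_mul, toReal_eLpNorm h2.1, toReal_eLpNorm h1.1, toReal_eLpNorm hG.1,
    ENNReal.coe_toReal, Real.rpow_two] at hR
  calc _ ≤ _ := hR
    _ = _ := by ring

lemma hasWeakGradient_of_contDiff {f : E d → ℝ} (hf : ContDiff ℝ ∞ f) (hc : HasCompactSupport f) :
    HasWeakGradient f (∇ f) where
  locallyIntegrable := hf.continuous.locallyIntegrable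
  locallyIntegrable_grad := (continuous_gradient (hf.of_le (by simp))).locallyIntegrable
  integral_eq φ hφ hφc := by
    have hfg := continuous_gradient (hf.of_le (by simp) : ContDiff ℝ 1 f)
    have hφg := continuous_gradient (hφ.of_le (by simp) : ContDiff ℝ 1 φ)
    have i1 : Integrable (fun x => f x • ∇ φ x) volume :=
      (hf.continuous.smul hφg).integrable_of_hasCompactSupport hc.smul_right
    have i2 : Integrable (fun x => φ x • ∇ f x) volume :=
      (hφ.continuous.smul hfg).integrable_of_hasCompactSupport hφc.smul_right
    have i3 : Integrable (fun x => f x * φ x) volume :=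
      (hf.continuous.mul hφ.continuous).integrable_of_hasCompactSupport hc.mul_right
    refine ext_inner_right ℝ fun v => ?_
    rw [inner_neg_left, real_inner_comm, real_inner_comm v, ← integral_inner i1, ← integral_inner i2]
    have e : ∀ p q : E d → ℝ, ∀ x, ⟪v, p x • ∇ q x⟫ = p x * fderiv ℝ q x v := fun p q x => by
      rw [real_inner_smul_right, inner_gradient_right]
      simp
    have j1 := i1.const_inner (𝕜 := ℝ) v
    have j2 := i2.const_inner (𝕜 := ℝ) v
    simp only [e] at j1 j2 ⊢
    have j2' : Integrable (fun x => fderiv ℝ f x v * φ x) volume :=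
      j2.congr (.of_forall fun x => mul_comm _ _)
    rw [integral_mul_fderiv_eq_neg_fderiv_mul_of_integrable j2' j1 i3
      (fun x _ => hf.differentiable (by simp) x) (fun x _ => hφ.differentiable (by simp) x)]
    simp_rw [mul_comm]

lemma exists_pos_le_nashConstants (hd : 3 ≤ d) : ∃ c > 0, ∀ C ∈ nashConstants d, c ≤ C := by
  let b : ContDiffBump (0 : E d) := ⟨1, 2, by norm_num, by norm_num⟩
  have hbs : ContDiff ℝ ∞ b := b.contDiff
  have hbc : HasCompactSupport b := b.hasCompactSupport
  have m1 := memLp_of_contDiff hbs hbc 1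
  have m2 := memLp_of_contDiff hbs hbc 2
  have mG := memLp_gradient_of_contDiff hbs hbc 2
  have hineq : ∀ C ∈ nashConstants d, _ := fun C hC =>
    hC b (∇ b) m1 m2 mG (hasWeakGradient_of_contDiff hbs hbc)
  have h0 : 0 < lpNorm b 2 (volume : Measure (E d)) := by
    refine lpNorm_nonneg.lt_of_ne' fun h => ?_
    rw [lpNorm_eq_zero m2 (by norm_num)] at h
    have := (Continuous.ae_eq_iff_eq volume b.continuous continuous_zero).1 h
    have h1 : b 0 = 1 := b.one_of_mem_closedBall (by simp [b])
    rw [this] at h1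
    simp at h1
  have hL : 0 < lpNorm b 2 (volume : Measure (E d)) ^ (2 + 4 / (d : ℝ)) := Real.rpow_pos_of_pos h0 _
  set R := lpNorm b 1 (volume : Measure (E d)) ^ (4 / (d : ℝ)) * lpNorm (∇ b) 2 volume ^ 2 with hR
  have hR0 : 0 ≤ R := mul_nonneg (Real.rpow_nonneg lpNorm_nonneg _) (sq_nonneg _)
  obtain ⟨C₀, hC₀, _⟩ := nashConstants_nonempty hd
  -- If the right side vanished, the admissible constant `C₀` would force the bump to have zero `L²`
  -- norm.
  have hRpos : 0 < R := by
    refine hR0.lt_of_ne' fun h => ?_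
    have := hineq C₀ hC₀
    rw [mul_assoc, ← hR, h, mul_zero] at this
    linarith
  refine ⟨_, div_pos hL hRpos, fun C hC => ?_⟩
  rw [div_le_iff₀ hRpos, hR, ← mul_assoc]
  exact hineq C hC

/-- The admissible constants form an intersection of closed sets, nonempty by Sobolev and bounded
below by a positive number by testing a bump, so the infimum is positive and attained. -/
lemma nashConst_pos_and_isLeast (hd : 3 ≤ d) :
    0 < nashConst d ∧ IsLeast (nashConstants d) (nashConst d) := by
  obtain ⟨C₀, hC₀, _⟩ := nashConstants_nonempty hd
  obtain ⟨c, hc, hle⟩ := exists_pos_le_nashConstants hd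
  have hbdd : BddBelow (nashConstants d) := ⟨c, hle⟩
  have hne : (nashConstants d).Nonempty := ⟨C₀, hC₀⟩
  refine ⟨hc.trans_le (le_csInf hne hle), ?_, fun C hC => csInf_le hbdd hC⟩
  have hcl : IsClosed (nashConstants d) := by
    simp only [nashConstants, ofPred_forall]
    refine isClosed_iInter fun u => isClosed_iInter fun G => isClosed_iInter fun _ =>
      isClosed_iInter fun _ => isClosed_iInter fun _ => isClosed_iInter fun _ => ?_
    exact isClosed_le continuous_const (by fun_prop)
  exact hcl.csInf_mem hne hbdd

/-! ### From increments to an integrated energy inequality -/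

section Time

variable {H : Type*} [NormedAddCommGroup H] [NormedSpace ℝ H] [CompleteSpace H]

/-- Backward Steklov averages converge in `L²`. -/
lemma exists_eLpNorm_sub_steklov_le {F : ℝ → H} {b : ℝ}
    (hF : MemLp F 2 (volume.restrict (Ioc 0 b))) {δ : ℝ≥0∞} (hδ : 0 < δ) :
    ∃ r > 0, ∀ a h : ℝ, 0 < h → h ≤ r → h ≤ a →
      eLpNorm (fun t => F t - h⁻¹ • ∫ s in (t - h)..t, F s) 2 (volume.restrict (Ioc a b)) ≤ δ := by
  -- Extension by zero reduces to averages on the whole line. The condition `h ≤ a` keeps every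
  -- window `(t - h, t]` inside `(0, b]`, where the extension agrees with `F`.
  have hF' : MemLp ((Ioc 0 b).indicator F) 2 volume :=
    (memLp_indicator_iff_restrict measurableSet_Ioc).2 hF
  obtain ⟨r, hr, hA⟩ := exists_eLpNorm_sub_average_le volume hF' hδ
  refine ⟨r, hr, fun a h hh hhr hha => ?_⟩
  let ν : Measure ℝ := (ENNReal.ofReal h)⁻¹ • volume.restrict (Ioc 0 h)
  have hν : IsProbabilityMeasure ν := by
    constructor
    simp only [ν, Measure.smul_apply, Measure.restrict_apply MeasurableSet.univ, univ_inter,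
      Real.volume_Ioc, sub_zero, smul_eq_mul]
    exact ENNReal.inv_mul_cancel (by simpa using hh) ENNReal.ofReal_ne_top
  have hνr : ∀ᵐ y ∂ν, ‖y‖ ≤ r := by
    refine Measure.ae_smul_measure ?_ _
    filter_upwards [ae_restrict_mem measurableSet_Ioc] with y hy
    rw [Real.norm_of_nonneg hy.1.le]
    exact hy.2.trans hhr
  refine le_trans (le_of_eq (eLpNorm_congr_ae ?_))
    ((eLpNorm_mono_measure _ (Measure.restrict_le_self (s := Ioc a b))).trans (hA ν hν hνr))
  filter_upwards [ae_restrict_mem measurableSet_Ioc] with t ht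
  have h0t : 0 < t := by linarith [ht.1]
  rw [indicator_of_mem (show t ∈ Ioc 0 b from ⟨h0t, ht.2⟩)]
  congr 1
  simp only [ν]
  rw [integral_smul_measure, ← intervalIntegral.integral_of_le hh.le,
    intervalIntegral.integral_comp_sub_left (fun s => (Ioc 0 b).indicator F s) t, sub_zero,
    ENNReal.toReal_inv, ENNReal.toReal_ofReal hh.le]
  congr 1
  refine intervalIntegral.integral_congr_ae (.of_forall fun s hs => ?_)
  rw [uIoc_of_le (by linarith)] at hs
  rw [indicator_of_mem]
  exact ⟨by linarith [hs.1, ht.1], hs.2.trans ht.2⟩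

/-- A one-sided energy inequality between nearby times, with an error controlled by the modulus
of continuity of `F`, integrates to an energy inequality. -/
lemma sub_le_neg_integral_of_increment_le {F : ℝ → H} {y X N : ℝ → ℝ}
    (hF : ∀ T, MemLp F 2 (volume.restrict (Ioc 0 T))) (hy : ContinuousOn y (Ici 0))
    (hX : ∀ T, IntegrableOn X (Ioc 0 T)) (hN : ∀ T, MemLp N 2 (volume.restrict (Ioc 0 T)))
    (hinc : ∀ᵐ t ∂(volume.restrict (Ioi (0 : ℝ))), ∀ s, 0 ≤ s → s ≤ t →
      y t - y s ≤ -((t - s) * X t) + N t * ‖(t - s) • F t - ∫ r in s..t, F r‖)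
    {a b : ℝ} (ha : 0 ≤ a) (hab : a ≤ b) : y b - y a ≤ -∫ t in a..b, X t := by
  have hyint : ∀ p q : ℝ, 0 ≤ p → p ≤ q → IntervalIntegrable y volume p q := fun p q hp hpq =>
    (hy.mono (by rw [uIcc_of_le hpq]; exact fun x hx => hp.trans hx.1)).intervalIntegrable
  have hXint : ∀ p q : ℝ, 0 ≤ p → p ≤ q → IntervalIntegrable X volume p q := fun p q hp hpq =>
    (intervalIntegrable_iff_integrableOn_Ioc_of_le hpq).2
      ((hX q).mono_set (Ioc_subset_Ioc_left hp))
  have hpos : ∀ a, 0 < a → a ≤ b → y b - y a ≤ -∫ t in a..b, X t := by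
    intro a ha hab
    set c : ℝ := lpNorm N 2 (volume.restrict (Ioc 0 b)) with hc
    have hδ : ∀ δ : ℝ, 0 < δ → y b - y a - 2 * δ ≤ -(∫ t in a..b, X t) + c * δ := by
      intro δ hδ
      obtain ⟨r, hr, hS⟩ := exists_eLpNorm_sub_steklov_le (hF b) (ENNReal.ofReal_pos.2 hδ)
      have hnear : ∀ p, 0 < p → ∃ r > 0, ∀ t, p - r ≤ t → t ≤ p → |y t - y p| ≤ δ := fun p hp => by
        have := Metric.continuousAt_iff.1 (hy.continuousAt (Ici_mem_nhds hp)) δ hδ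
        obtain ⟨r, hr, h⟩ := this
        refine ⟨r / 2, by positivity, fun t h1 h2 => (h ?_).le⟩
        rw [Real.dist_eq, abs_lt]
        constructor <;> linarith
      obtain ⟨r₁, hr₁, hb⟩ := hnear b (ha.trans_le hab)
      obtain ⟨r₂, hr₂, hA⟩ := hnear a ha
      obtain ⟨h, hh, hhr, hh1, hh2, hha⟩ : ∃ h, 0 < h ∧ h ≤ r ∧ h ≤ r₁ ∧ h ≤ r₂ ∧ h ≤ a :=
        ⟨min (min r r₁) (min r₂ a), by positivity, (min_le_left _ _).trans (min_le_left _ _),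
          (min_le_left _ _).trans (min_le_right _ _), (min_le_right _ _).trans (min_le_left _ _),
          (min_le_right _ _).trans (min_le_right _ _)⟩
      have hE := hS a h hh hhr hha
      set e : ℝ → H := fun t => F t - h⁻¹ • ∫ s in (t - h)..t, F s with he
      have hIoc : Ioc a b ⊆ Ioc 0 b := Ioc_subset_Ioc_left ha.le
      have hFi : IntegrableOn F (Ioc 0 b) := (hF b).integrable (by norm_num)
      have hprim : ContinuousOn (fun t => ∫ s in (0 : ℝ)..t, F s) (Icc 0 b) :=
        intervalIntegral.continuousOn_primitive (by rwa [integrableOn_Icc_iff_integrableOn_Ioc]) |>.congr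
          fun t ht => intervalIntegral.integral_of_le ht.1
      have hFii : ∀ p q, 0 ≤ p → p ≤ q → q ≤ b → IntervalIntegrable F volume p q :=
        fun p q hp hpq hq => (intervalIntegrable_iff_integrableOn_Ioc_of_le hpq).2
          (hFi.mono_set (Ioc_subset_Ioc hp hq))
      have hem : AEStronglyMeasurable e (volume.restrict (Ioc a b)) := by
        refine ((hF b).1.mono_measure (Measure.restrict_mono hIoc le_rfl)).sub
          (AEStronglyMeasurable.const_smul ?_ _)
        have hcont : ContinuousOn (fun t => (∫ s in (0 : ℝ)..t, F s) -
            ∫ s in (0 : ℝ)..(t - h), F s) (Ioc a b) := by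
          refine (hprim.mono fun t ht => ⟨by linarith [ht.1], ht.2⟩).sub
            (hprim.comp (by fun_prop) fun t ht => ⟨by linarith [ht.1], by linarith [ht.2]⟩)
        refine (hcont.aestronglyMeasurable measurableSet_Ioc).congr ?_
        filter_upwards [ae_restrict_mem measurableSet_Ioc] with t ht
        exact intervalIntegral.integral_interval_sub_left
          (hFii _ _ le_rfl (by linarith [ht.1]) ht.2)
          (hFii _ _ le_rfl (by linarith [ht.1]) (by linarith [ht.2]))
      have heL : MemLp e 2 (volume.restrict (Ioc a b)) := ⟨hem, hE.trans_lt ENNReal.ofReal_lt_top⟩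
      have hNL : MemLp N 2 (volume.restrict (Ioc a b)) :=
        (hN b).mono_measure (Measure.restrict_mono hIoc le_rfl)
      have hNe_int : IntervalIntegrable (fun t => N t * ‖e t‖) volume a b :=
        (intervalIntegrable_iff_integrableOn_Ioc_of_le hab).2 (by
          refine (integrable_inner_of_memLp heL.norm hNL).congr (.of_forall fun t => ?_)
          simp)
      have hNe : ∫ t in a..b, N t * ‖e t‖ ≤ c * δ := by
        rw [intervalIntegral.integral_of_le hab]
        have h1 := inner_toLp heL.norm hNL
        have h2 := real_inner_le_norm (heL.norm.toLp _) (hNL.toLp N)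
        rw [h1, Lp.norm_toLp, Lp.norm_toLp, eLpNorm_norm] at h2
        have h3 : (eLpNorm e 2 (volume.restrict (Ioc a b))).toReal ≤ δ :=
          ENNReal.toReal_le_of_le_ofReal hδ.le hE
        have h4 : (eLpNorm N 2 (volume.restrict (Ioc a b))).toReal ≤ c := by
          rw [hc, ← toReal_eLpNorm (hN b).1]
          exact ENNReal.toReal_mono (hN b).2.ne
            (eLpNorm_mono_measure _ (Measure.restrict_mono hIoc le_rfl))
        have h5 : ∫ t in Ioc a b, N t * ‖e t‖ = ∫ t in Ioc a b, ⟪‖e t‖, N t⟫ :=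
          integral_congr_ae (.of_forall fun t => by simp)
        rw [h5]
        refine h2.trans ?_
        rw [mul_comm]
        exact mul_le_mul h4 h3 ENNReal.toReal_nonneg lpNorm_nonneg
      have hsh : IntervalIntegrable (fun t => y (t - h)) volume a b := by
        have := (hyint (a - h) (b - h) (by linarith) (by linarith)).comp_sub_right h
        simpa using this
      -- The increment inequality with `s = t - h`, integrated over `t`. The left side telescopes
      -- into averages of `y` near `b` and near `a`; after division by `h` the total error is `(c +
      -- 2)δ`.
      have hmain : ∫ t in a..b, (y t - y (t - h)) ≤
          ∫ t in a..b, (-(h * X t) + h * (N t * ‖e t‖)) := by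
        refine intervalIntegral.integral_mono_ae_restrict hab ((hyint a b ha.le hab).sub hsh)
          (((hXint a b ha.le hab).const_mul h).neg.add (hNe_int.const_mul h)) ?_
        rw [← Measure.restrict_congr_set Ioc_ae_eq_Icc]
        have hinc' := ae_mono (Measure.restrict_mono (show Ioc a b ⊆ Ioi 0 from
          fun t ht => ha.trans ht.1) le_rfl) hinc
        filter_upwards [hinc', ae_restrict_mem measurableSet_Ioc] with t ht hm
        have h1 := ht (t - h) (by linarith [hm.1]) (by linarith)
        have h2 : (t - (t - h)) • F t - ∫ r in (t - h)..t, F r = h • e t := by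
          rw [sub_sub_cancel, he, smul_sub, smul_smul, mul_inv_cancel₀ hh.ne', one_smul]
        rw [h2, sub_sub_cancel, norm_smul, Real.norm_of_nonneg hh.le] at h1
        linarith
      have hL : ∫ t in a..b, (y t - y (t - h)) =
          (∫ t in (b - h)..b, y t) - ∫ t in (a - h)..a, y t := by
        rw [intervalIntegral.integral_sub (hyint a b ha.le hab) hsh,
          intervalIntegral.integral_comp_sub_right (fun t => y t) h]
        have h1 := intervalIntegral.integral_add_adjacent_intervals
          (hyint (a - h) a (by linarith) (by linarith)) (hyint a b ha.le hab)
        have h2 := intervalIntegral.integral_add_adjacent_intervals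
          (hyint (a - h) (b - h) (by linarith) (by linarith))
          (hyint (b - h) b (by linarith) (by linarith))
        linarith
      have hb1 : h * (y b - δ) ≤ ∫ t in (b - h)..b, y t := by
        have := intervalIntegral.integral_mono_on (by linarith : b - h ≤ b)
          (intervalIntegrable_const (c := y b - δ)) (hyint (b - h) b (by linarith) (by linarith))
          fun t ht => by linarith [(abs_le.1 (hb t (by linarith [ht.1]) ht.2)).1]
        simp only [intervalIntegral.integral_const, sub_sub_cancel, smul_eq_mul] at this
        exact this
      have ha1 : ∫ t in (a - h)..a, y t ≤ h * (y a + δ) := by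
        have := intervalIntegral.integral_mono_on (by linarith : a - h ≤ a)
          (hyint (a - h) a (by linarith) (by linarith)) (intervalIntegrable_const (c := y a + δ))
          fun t ht => by linarith [(abs_le.1 (hA t (by linarith [ht.1]) ht.2)).2]
        simp only [intervalIntegral.integral_const, sub_sub_cancel, smul_eq_mul] at this
        exact this
      have hXh : IntervalIntegrable (fun t => -(h * X t)) volume a b :=
        ((hXint a b ha.le hab).const_mul h).neg
      rw [hL, intervalIntegral.integral_add hXh
        (hNe_int.const_mul h), intervalIntegral.integral_neg, intervalIntegral.integral_const_mul,
        intervalIntegral.integral_const_mul] at hmain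
      have : h * (y b - y a - 2 * δ) ≤ h * (-(∫ t in a..b, X t) + c * δ) := by
        have := mul_le_mul_of_nonneg_left hNe hh.le
        linarith
      exact le_of_mul_le_mul_left this hh
    have hc0 : 0 ≤ c := lpNorm_nonneg
    refine le_of_forall_pos_le_add fun ε hε => ?_
    have := hδ (ε / (c + 2)) (by positivity)
    have h2 : ε / (c + 2) * (c + 2) = ε := by field_simp
    linarith
  rcases ha.eq_or_lt with rfl | ha
  swap
  · exact hpos a ha hab
  rcases hab.eq_or_lt with rfl | hb
  · simp
  -- The endpoint `a = 0` leaves no room for backward windows and is reached by continuity of `y`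
  -- and of the primitive of `X`.
  have hXI : IntegrableOn X (Icc 0 b) := by rw [integrableOn_Icc_iff_integrableOn_Ioc]; exact hX b
  have hcont : ContinuousOn (fun t => ∫ s in (0 : ℝ)..t, X s) (Icc 0 b) :=
    (intervalIntegral.continuousOn_primitive hXI).congr
      fun t ht => intervalIntegral.integral_of_le ht.1
  have hsub : Ioc (0 : ℝ) b ⊆ Icc 0 b := Ioc_subset_Icc_self
  have hne : (𝓝[Ioc 0 b] (0 : ℝ)).NeBot := by
    rw [← mem_closure_iff_nhdsWithin_neBot, closure_Ioc hb.ne]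
    exact left_mem_Icc.2 hb.le
  have l1 : Tendsto (fun a => y b - y a) (𝓝[Ioc 0 b] 0) (𝓝 (y b - y 0)) :=
    ((hy 0 self_mem_Ici).mono_left (nhdsWithin_mono _ fun t ht => ht.1.le)).const_sub _
  have l2 : Tendsto (fun a => -((∫ s in (0 : ℝ)..b, X s) - ∫ s in (0 : ℝ)..a, X s))
      (𝓝[Ioc 0 b] 0) (𝓝 (-((∫ s in (0 : ℝ)..b, X s) - ∫ s in (0 : ℝ)..0, X s))) :=
    (((hcont 0 (left_mem_Icc.2 hb.le)).mono_left (nhdsWithin_mono _ hsub)).const_sub _).neg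
  rw [intervalIntegral.integral_same, sub_zero] at l2
  refine le_of_tendsto_of_tendsto l1 l2 ?_
  filter_upwards [self_mem_nhdsWithin] with a ha
  rw [intervalIntegral.integral_interval_sub_left (hXint 0 b le_rfl hb.le)
    (hXint 0 a le_rfl ha.1.le)]
  exact hpos a ha.1 ha.2

end Time

/-! ### The drift and the flux of a weak solution -/

lemma gradient_half_log {γ η : ℝ} {x : E d} (hx : η + ‖x‖ ^ 2 ≠ 0) :
    ∇ (fun y : E d => γ / 2 * Real.log (η + ‖y‖ ^ 2)) x = γ • hardyField η x := by
  refine HasGradientAt.gradient ?_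
  rw [hasGradientAt_iff_hasFDerivAt]
  have h1 : HasFDerivAt (fun y : E d => η + ‖y‖ ^ 2) (2 • innerSL ℝ x) x :=
    (hasStrictFDerivAt_norm_sq x).hasFDerivAt.const_add η
  refine ((h1.log hx).const_mul (γ / 2)).congr_fderiv ?_
  ext v
  simp [hardyField]
  ring

/-- Both potentials equal `(γ/2) log(η + |x|²)`, with `η = 0` and `η = 1`. The exceptional set is
the origin in the first case. -/
lemma ae_gradient_potential (hd : 1 ≤ d) {γ : ℝ} {V : E d → ℝ}
    (hV : V = potentialOne γ ∨ V = potentialTwo γ) :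
    ∃ η : ℝ, 0 ≤ η ∧ ∀ᵐ x, ∇ V x = γ • hardyField η x := by
  rcases hV with rfl | rfl
  · refine ⟨0, le_rfl, ?_⟩
    have : Nonempty (Fin d) := ⟨⟨0, hd⟩⟩
    have e : potentialOne γ = fun y : E d => γ / 2 * Real.log (0 + ‖y‖ ^ 2) := by
      ext y
      rw [potentialOne, zero_add, Real.log_pow]
      push_cast
      ring
    have hne : ∀ᵐ x : E d, x ≠ 0 := by simp [ae_iff, measure_singleton]
    filter_upwards [hne] with x hx
    rw [e]
    have : 0 < ‖x‖ := norm_pos_iff.2 hx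
    exact gradient_half_log (by positivity)
  · refine ⟨1, zero_le_one, .of_forall fun x => ?_⟩
    have e : potentialTwo γ = fun y : E d => γ / 2 * Real.log (1 + ‖y‖ ^ 2) := by
      ext y
      rw [potentialTwo, Real.log_sqrt (by positivity)]
      ring
    rw [e]
    exact gradient_half_log (by positivity)

open Classical in
/-- The product of an `L²` function with the field `x / (η + |x|²)`, or zero if it is not
square integrable. -/
noncomputable def drift (η : ℝ) (v : Lp ℝ 2 (volume : Measure (E d))) :
    Lp (E d) 2 (volume : Measure (E d)) :=
  if m : MemLp (fun x => v x • hardyField η x) 2 volume then m.toLp _ else 0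

lemma drift_eq {η : ℝ} {v : Lp ℝ 2 (volume : Measure (E d))}
    (m : MemLp (fun x => v x • hardyField η x) 2 volume) : drift η v = m.toLp _ :=
  dif_pos m

lemma coeFn_drift {η : ℝ} {v : Lp ℝ 2 (volume : Measure (E d))}
    (m : MemLp (fun x => v x • hardyField η x) 2 volume) :
    drift η v =ᵐ[volume] fun x => v x • hardyField η x := by
  rw [drift_eq m]
  exact m.coeFn_toLp

lemma continuous_drift {η : ℝ} (hη : 0 < η) : Continuous (drift (d := d) η) := by
  have hlip : LipschitzWith (Real.toNNReal (1 + η⁻¹)) (drift (d := d) η) := by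
    refine LipschitzWith.of_dist_le_mul fun v w => ?_
    rw [dist_eq_norm, dist_eq_norm, Real.coe_toNNReal _ (by positivity)]
    refine Lp.norm_le_mul_norm_of_ae_le_mul ?_
    filter_upwards [Lp.coeFn_sub (drift η v) (drift η w), Lp.coeFn_sub v w,
      coeFn_drift (memLp_smul_hardyField hη (Lp.memLp v)),
      coeFn_drift (memLp_smul_hardyField hη (Lp.memLp w))] with x h1 h2 h3 h4
    rw [h1, h2, Pi.sub_apply, Pi.sub_apply, h3, h4, ← sub_smul, norm_smul, mul_comm]
    exact mul_le_mul_of_nonneg_right (norm_hardyField_le hη x) (norm_nonneg _)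
  exact hlip.continuous

lemma HasWeakGradient.exists_approx_lp {v : Lp ℝ 2 (volume : Measure (E d))}
    {g : Lp (E d) 2 (volume : Measure (E d))} (h : HasWeakGradient v g) : ∃ φ, ApproxH1 v g φ :=
  h.exists_approx (Lp.memLp v) (Lp.memLp g)

lemma HasWeakGradient.memLp_drift (hd : 3 ≤ d) {η : ℝ} (hη : 0 ≤ η)
    {v : Lp ℝ 2 (volume : Measure (E d))} {g : Lp (E d) 2 (volume : Measure (E d))}
    (h : HasWeakGradient v g) : MemLp (fun x => v x • hardyField η x) 2 volume := by
  obtain ⟨φ, hφ⟩ := h.exists_approx_lp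
  exact hφ.memLp_smul_hardyField hd hη (Lp.memLp v) (Lp.memLp g)

/-- Hardy's inequality. -/
lemma HasWeakGradient.norm_drift_le (hd : 3 ≤ d) {η : ℝ} (hη : 0 ≤ η)
    {v : Lp ℝ 2 (volume : Measure (E d))} {g : Lp (E d) 2 (volume : Measure (E d))}
    (h : HasWeakGradient v g) : ‖drift η v‖ ≤ ‖g‖ / (((d : ℝ) - 2) / 2) := by
  have hd' : (0 : ℝ) < ((d : ℝ) - 2) / 2 := by
    have : (3 : ℝ) ≤ d := by exact_mod_cast hd
    linarith
  obtain ⟨φ, hφ⟩ := h.exists_approx_lp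
  have m := h.memLp_drift hd hη
  refine norm_le_div_of_mul_sq_le hd' ?_
  have h1 := hardyWeight_one.hardy hd hη (Lp.memLp v) (Lp.memLp g) hφ
  simp only [mul_one] at h1
  have e := inner_toLp m (Lp.memLp g)
  rw [Lp.toLp_coeFn] at e
  rw [← real_inner_self_eq_norm_sq, drift_eq m, inner_toLp, e]
  exact h1

/-- The flux of a weak solution is square integrable in space and time. -/
lemma IsWeakSolution.exists_flux (hd : 3 ≤ d) {γ η : ℝ} (hη : 0 ≤ η) {V u₀ : E d → ℝ}
    (hV : ∀ᵐ x, ∇ V x = γ • hardyField η x) {u : ℝ → Lp ℝ 2 (volume : Measure (E d))}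
    (h : IsWeakSolution V u₀ u) :
    ∃ G F : ℝ → Lp (E d) 2 (volume : Measure (E d)),
      (∀ T, MemLp G 2 (volume.restrict (Ioc 0 T))) ∧
      (∀ T, MemLp F 2 (volume.restrict (Ioc 0 T))) ∧
      (∀ᵐ t ∂(volume.restrict (Ioi (0 : ℝ))), HasWeakGradient (u t) (G t) ∧
        F t =ᵐ[volume] fun x => G t x + γ • u t x • hardyField η x) ∧
      ∀ φ : E d → ℝ, ContDiff ℝ ∞ φ → HasCompactSupport φ → ∀ t : ℝ, 0 ≤ t →
        ∫ x, u t x * φ x =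
          (∫ x, u₀ x * φ x) - ∫ s in (0 : ℝ)..t, ∫ x, ⟪F s x, ∇ φ x⟫ := by
  obtain ⟨G, hG, hw, heq⟩ := h.equation
  have hd' : (0 : ℝ) < ((d : ℝ) - 2) / 2 := by
    have : (3 : ℝ) ≤ d := by exact_mod_cast hd
    linarith
  have hle : ∀ T : ℝ, volume.restrict (Ioc 0 T) ≤ volume.restrict (Ioi (0 : ℝ)) := fun T =>
    Measure.restrict_mono Ioc_subset_Ioi_self le_rfl
  let c : ℕ → ℝ := fun n => η + 1 / ((n : ℝ) + 1)
  have hc : ∀ n, 0 < c n := fun n => by positivity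
  have hcη : ∀ n, η ≤ c n := fun n => le_add_of_nonneg_right (by positivity)
  have hcl : Tendsto c atTop (𝓝 η) := by
    simpa [c] using tendsto_one_div_add_atTop_nhds_zero_nat.const_add η
  -- For `η = 0` multiplication by the field is unbounded on `L²`. Measurability in time comes from
  -- the continuous regularised drifts, which converge at almost every time by Hardy's inequality.
  have hDm : AEStronglyMeasurable (fun t => drift η (u t)) (volume.restrict (Ioi (0 : ℝ))) := by
    refine aestronglyMeasurable_of_tendsto_ae atTop (f := fun n t => drift (c n) (u t))
      (fun n => ?_) ?_
    · exact (((continuous_drift (hc n)).comp_continuousOn h.continuousOn).mono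
        Ioi_subset_Ici_self).aestronglyMeasurable measurableSet_Ioi
    · filter_upwards [hw] with t ht
      have m := ht.memLp_drift hd hη
      have mn := fun n => memLp_smul_hardyField (hc n) (Lp.memLp (u t))
      simp_rw [drift_eq m, fun n => drift_eq (mn n)]
      exact (Lp.tendsto_Lp_iff_tendsto_eLpNorm'' _ mn _ m).2
        (tendsto_smul_hardyField (Lp.memLp (u t)).1 hη m hcη hcl)
  have hD : ∀ T, MemLp (fun t => drift η (u t)) 2 (volume.restrict (Ioc 0 T)) := fun T => by
    refine MemLp.of_le_mul (c := (((d : ℝ) - 2) / 2)⁻¹) (hG T) (hDm.mono_measure (hle T)) ?_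
    filter_upwards [ae_mono (hle T) hw] with t ht
    rw [inv_mul_eq_div]
    exact ht.norm_drift_le hd hη
  have hFae : ∀ᵐ t ∂(volume.restrict (Ioi (0 : ℝ))),
      (G t + γ • drift η (u t) : Lp (E d) 2 volume) =ᵐ[volume]
        fun x => G t x + γ • u t x • hardyField η x := by
    filter_upwards [hw] with t ht
    filter_upwards [coeFn_drift (ht.memLp_drift hd hη), Lp.coeFn_add (G t) (γ • drift η (u t)),
      Lp.coeFn_smul γ (drift η (u t))] with x h1 h2 h3
    rw [h2, Pi.add_apply, h3, Pi.smul_apply, h1]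
  refine ⟨G, fun t => G t + γ • drift η (u t), hG, fun T => (hG T).add ((hD T).const_smul γ),
    hw.and hFae, fun φ hφ hφc t ht => ?_⟩
  rw [heq φ hφ hφc t ht]
  congr 1
  rw [intervalIntegral.integral_of_le ht, intervalIntegral.integral_of_le ht]
  refine integral_congr_ae ?_
  filter_upwards [ae_mono (hle t) hFae] with s hs
  refine integral_congr_ae ?_
  filter_upwards [hs, hV] with x h1 h2
  rw [h1, h2, smul_comm]

/-! ### Energy inequality and `L¹` contraction -/

/-- The weak formulation extends to test functions in `H¹`. -/
lemma inner_sub_eq_of_weak {u₀ : E d → ℝ} {u : ℝ → Lp ℝ 2 (volume : Measure (E d))}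
    {F : ℝ → Lp (E d) 2 (volume : Measure (E d))}
    (hF : ∀ T, MemLp F 2 (volume.restrict (Ioc 0 T)))
    (heq : ∀ φ : E d → ℝ, ContDiff ℝ ∞ φ → HasCompactSupport φ → ∀ t : ℝ, 0 ≤ t →
        ∫ x, u t x * φ x = (∫ x, u₀ x * φ x) - ∫ s in (0 : ℝ)..t, ∫ x, ⟪F s x, ∇ φ x⟫)
    {v : E d → ℝ} {W : E d → E d} {φ : ℕ → E d → ℝ} (hv : MemLp v 2 volume)
    (hW : MemLp W 2 volume) (hφ : ApproxH1 v W φ) {s t : ℝ} (hs : 0 ≤ s) (hst : s ≤ t) :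
    ⟪u t - u s, hv.toLp v⟫ = -⟪∫ r in s..t, F r, hW.toLp W⟫ := by
  have hFi : ∀ p q : ℝ, 0 ≤ p → p ≤ q → IntervalIntegrable F volume p q := fun p q hp hpq =>
    (intervalIntegrable_iff_integrableOn_Ioc_of_le hpq).2
      (IntegrableOn.mono_set ((hF q).integrable (by norm_num)) (Ioc_subset_Ioc_left hp))
  have m := fun n => memLp_of_contDiff (hφ.contDiff n) (hφ.hasCompactSupport n) 2
  have mg := fun n => memLp_gradient_of_contDiff (hφ.contDiff n) (hφ.hasCompactSupport n) 2
  have htest : ∀ n, ⟪u t - u s, (m n).toLp _⟫ = -⟪∫ r in s..t, F r, (mg n).toLp _⟫ := fun n => by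
    have e1 : ∀ w : Lp ℝ 2 (volume : Measure (E d)),
        ⟪w, (m n).toLp _⟫ = ∫ x, w x * φ n x := fun w => by
      have := inner_toLp (Lp.memLp w) (m n)
      rw [Lp.toLp_coeFn] at this
      rw [this]
      refine integral_congr_ae (.of_forall fun x => ?_)
      simp [mul_comm]
    have e2 : ∀ r, ∫ x, ⟪F r x, ∇ (φ n) x⟫ = ⟪(mg n).toLp _, F r⟫ := fun r => by
      have := inner_toLp (Lp.memLp (F r)) (mg n)
      rw [Lp.toLp_coeFn] at this
      rw [← this, real_inner_comm]
    have e3 : ∀ p q : ℝ, 0 ≤ p → p ≤ q → ∫ r in p..q, ⟪(mg n).toLp _, F r⟫ =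
        ⟪(mg n).toLp _, ∫ r in p..q, F r⟫ := fun p q hp hpq =>
      ((innerSL ℝ ((mg n).toLp _)).intervalIntegral_comp_comm (hFi p q hp hpq))
    have h1 := heq (φ n) (hφ.contDiff n) (hφ.hasCompactSupport n) t (hs.trans hst)
    have h2 := heq (φ n) (hφ.contDiff n) (hφ.hasCompactSupport n) s hs
    simp_rw [e2] at h1 h2
    rw [← e1, e3 0 t le_rfl (hs.trans hst)] at h1
    rw [← e1, e3 0 s le_rfl hs] at h2
    have c1 := real_inner_comm (∫ r in (0 : ℝ)..t, F r) ((mg n).toLp _)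
    have c2 := real_inner_comm (∫ r in (0 : ℝ)..s, F r) ((mg n).toLp _)
    rw [inner_sub_left, h1, h2, ← intervalIntegral.integral_interval_sub_left
      (hFi 0 t le_rfl (hs.trans hst)) (hFi 0 s le_rfl hs), inner_sub_left]
    linarith
  have l1 := (Lp.tendsto_Lp_iff_tendsto_eLpNorm'' _ m _ hv).2 hφ.tendsto
  have l2 := (Lp.tendsto_Lp_iff_tendsto_eLpNorm'' _ mg _ hW).2 hφ.tendsto_grad
  refine tendsto_nhds_unique ((tendsto_const_nhds (x := u t - u s)).inner l1) ?_
  simp_rw [htest]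
  exact (tendsto_const_nhds.inner l2).neg

/-- The test function is `β(u(t))`, with gradient `ζ(u(t)) G(t)`. Replacing `∫ F` over `[s,t]` by
`(t - s) F(t)` exposes the dissipation at time `t`; the remainder is bounded by Cauchy–Schwarz and
`ζ ≤ B`. -/
lemma increment_le (hd : 3 ≤ d) {γ η : ℝ} (hη : 0 ≤ η) {u₀ : E d → ℝ}
    {u : ℝ → Lp ℝ 2 (volume : Measure (E d))} {G F : ℝ → Lp (E d) 2 (volume : Measure (E d))}
    (hF : ∀ T, MemLp F 2 (volume.restrict (Ioc 0 T)))
    (heq : ∀ φ : E d → ℝ, ContDiff ℝ ∞ φ → HasCompactSupport φ → ∀ t : ℝ, 0 ≤ t →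
        ∫ x, u t x * φ x = (∫ x, u₀ x * φ x) - ∫ s in (0 : ℝ)..t, ∫ x, ⟪F s x, ∇ φ x⟫)
    {ζ h β : ℝ → ℝ} {B : ℝ} {K : ℝ≥0} (w : HardyWeight ζ h B K) (hβ : ContDiff ℝ ∞ β)
    (hβ0 : β 0 = 0) (hβζ : deriv β = ζ) {s t : ℝ} (hs : 0 ≤ s) (hst : s ≤ t)
    (hwt : HasWeakGradient (u t) (G t))
    (hFt : F t =ᵐ[volume] fun x => G t x + γ • u t x • hardyField η x)
    (hv : MemLp (fun x => β (u t x)) 2 volume) :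
    ⟪u t - u s, hv.toLp _⟫ ≤
      -((t - s) * (min 1 (1 - 2 * γ / ((d : ℝ) - 2)) * ∫ x, ζ (u t x) * ‖G t x‖ ^ 2)) +
        B * ‖G t‖ * ‖(t - s) • F t - ∫ r in s..t, F r‖ := by
  obtain ⟨φ, hφ⟩ := hwt.exists_approx_lp
  obtain ⟨ψ, hψ⟩ := hφ.comp (Lp.memLp _) (Lp.memLp _) hβ hβ0 (B := B) fun r => by
    rw [hβζ, abs_of_nonneg (w.nonneg r)]; exact w.le r
  rw [hβζ] at hψ
  have hW := w.memLp_smul (Lp.memLp (u t)) (Lp.memLp (G t))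
  rw [inner_sub_eq_of_weak hF heq hv hW hψ hs hst]
  have hdis := w.dissipation hd (γ := γ) hη (Lp.memLp (u t)) (Lp.memLp (G t)) hφ
  have e : ⟪F t, hW.toLp _⟫ = ∫ x, ⟪G t x + γ • u t x • hardyField η x, ζ (u t x) • G t x⟫ := by
    have := inner_toLp (Lp.memLp (F t)) hW
    rw [Lp.toLp_coeFn] at this
    rw [this]
    refine integral_congr_ae ?_
    filter_upwards [hFt] with x hx
    rw [hx]
  rw [← e] at hdis
  have hWn : ‖hW.toLp _‖ ≤ B * ‖G t‖ := by
    refine Lp.norm_le_mul_norm_of_ae_le_mul ?_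
    filter_upwards [hW.coeFn_toLp] with x hx
    rw [hx, norm_smul, Real.norm_of_nonneg (w.nonneg _)]
    exact mul_le_mul_of_nonneg_right (w.le _) (norm_nonneg _)
  have hsplit : -⟪∫ r in s..t, F r, hW.toLp _⟫ = -((t - s) * ⟪F t, hW.toLp _⟫) +
      ⟪(t - s) • F t - ∫ r in s..t, F r, hW.toLp _⟫ := by
    rw [inner_sub_left, real_inner_smul_left]
    ring
  rw [hsplit]
  have h1 := mul_le_mul_of_nonneg_left hdis (sub_nonneg.2 hst)
  have h2 := real_inner_le_norm ((t - s) • F t - ∫ r in s..t, F r) (hW.toLp _)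
  have h3 := mul_le_mul_of_nonneg_left hWn (norm_nonneg ((t - s) • F t - ∫ r in s..t, F r))
  linarith

/-- The regularisation is at most `s²/(2ε)`, so its integral is finite on all of `L²`, before
anything is known about integrability of `u(t)`. -/
lemma integrable_smoothAbs {ε : ℝ} (hε : 0 < ε) (v : Lp ℝ 2 (volume : Measure (E d))) :
    Integrable (fun x => smoothAbs ε (v x)) volume := by
  have hsq : Integrable (fun x => (2 * ε)⁻¹ * (v x) ^ 2) volume :=
    (Lp.memLp v).integrable_sq.const_mul _
  refine hsq.mono' ((continuous_smoothAbs ε).comp_aestronglyMeasurable (Lp.memLp v).1)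
    (.of_forall fun x => ?_)
  have := abs_smoothAbs_sub_le hε (v x) 0
  rw [smoothAbs_zero hε, sub_zero, sub_zero, add_zero, abs_mul_abs_self] at this
  rw [Real.norm_eq_abs, sq]
  exact this

lemma continuous_integral_smoothAbs {ε : ℝ} (hε : 0 < ε) :
    Continuous fun v : Lp ℝ 2 (volume : Measure (E d)) => ∫ x, smoothAbs ε (v x) := by
  have hbound : ∀ v w : Lp ℝ 2 (volume : Measure (E d)),
      ‖(∫ x, smoothAbs ε (v x)) - ∫ x, smoothAbs ε (w x)‖ ≤
        (2 * ε)⁻¹ * (‖v - w‖ * ‖v + w‖) := fun v w => by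
    have h1 := inner_toLp (Lp.memLp (v - w)).norm (Lp.memLp (v + w)).norm
    have h2 := real_inner_le_norm ((Lp.memLp (v - w)).norm.toLp _) ((Lp.memLp (v + w)).norm.toLp _)
    rw [h1, Lp.norm_toLp, Lp.norm_toLp, eLpNorm_norm, eLpNorm_norm, ← Lp.norm_def, ← Lp.norm_def]
      at h2
    rw [← integral_sub (integrable_smoothAbs hε v) (integrable_smoothAbs hε w)]
    refine (norm_integral_le_integral_norm _).trans (le_trans ?_
      (mul_le_mul_of_nonneg_left h2 (by positivity)))
    rw [← integral_const_mul]
    refine integral_mono_ae ((integrable_smoothAbs hε v).sub (integrable_smoothAbs hε w)).norm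
      ((integrable_inner_of_memLp (Lp.memLp (v - w)).norm (Lp.memLp (v + w)).norm).const_mul _) ?_
    filter_upwards [Lp.coeFn_sub v w, Lp.coeFn_add v w] with x h3 h4
    have := abs_smoothAbs_sub_le hε (v x) (w x)
    simp only [h3, h4, Pi.sub_apply, Pi.add_apply, Real.norm_eq_abs]
    refine this.trans_eq ?_
    simp [mul_comm]
  refine continuous_iff_continuousAt.2 fun w => ?_
  rw [ContinuousAt, tendsto_iff_norm_sub_tendsto_zero]
  refine squeeze_zero (fun _ => norm_nonneg _) (fun v => hbound v w) ?_
  have : Continuous fun v : Lp ℝ 2 (volume : Measure (E d)) =>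
      (2 * ε)⁻¹ * (‖v - w‖ * ‖v + w‖) := by fun_prop
  simpa using this.tendsto w

lemma min_one_pos (hd : 3 ≤ d) {γ : ℝ} (hγ : γ < ((d : ℝ) - 2) / 2) :
    0 < min 1 (1 - 2 * γ / ((d : ℝ) - 2)) := by
  have : (3 : ℝ) ≤ d := by exact_mod_cast hd
  refine lt_min one_pos (sub_pos.2 ?_)
  rw [div_lt_one (by linarith)]
  linarith

/-- The energy inequality and the `L¹` contraction property of weak solutions. -/
lemma IsWeakSolution.energy_and_contraction (hd : 3 ≤ d) {γ η : ℝ} (hγ : γ < ((d : ℝ) - 2) / 2)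
    (hη : 0 ≤ η) {V u₀ : E d → ℝ} (hV : ∀ᵐ x, ∇ V x = γ • hardyField η x)
    {u : ℝ → Lp ℝ 2 (volume : Measure (E d))} (h : IsWeakSolution V u₀ u) :
    ∃ G : ℝ → Lp (E d) 2 (volume : Measure (E d)),
      (∀ T, MemLp G 2 (volume.restrict (Ioc 0 T))) ∧
      (∀ᵐ t ∂(volume.restrict (Ioi (0 : ℝ))), HasWeakGradient (u t) (G t)) ∧
      (∀ a b, 0 ≤ a → a ≤ b → ‖u b‖ ^ 2 - ‖u a‖ ^ 2 ≤
        -∫ t in a..b, 2 * (min 1 (1 - 2 * γ / ((d : ℝ) - 2)) * ‖G t‖ ^ 2)) ∧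
      ∀ ε > 0, ∀ t, 0 ≤ t → ∫ x, smoothAbs ε (u t x) ≤ ∫ x, smoothAbs ε (u 0 x) := by
  obtain ⟨G, F, hG, hF, hae, heq⟩ := h.exists_flux hd hη hV
  have hκ := min_one_pos hd hγ
  refine ⟨G, hG, hae.mono fun t ht => ht.1, fun a b ha hab => ?_, fun ε hε t ht => ?_⟩
  · refine sub_le_neg_integral_of_increment_le (N := fun t => 2 * ‖G t‖) hF
      (h.continuousOn.norm.pow 2) (fun T => ?_) (fun T => (hG T).norm.const_mul 2) ?_ ha hab
    · have : IntegrableOn (fun t => ‖G t‖ ^ 2) (Ioc 0 T) := (hG T).norm.integrable_sq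
      exact (this.const_mul _).const_mul 2
    · filter_upwards [hae] with t ht s hs hst
      have hv : MemLp (fun x => id (u t x)) 2 volume := Lp.memLp (u t)
      have hinc := increment_le hd hη hF heq hardyWeight_one contDiff_id rfl (by ext; simp) hs hst
        ht.1 ht.2 hv
      have e1 : hv.toLp _ = u t := Lp.toLp_coeFn _ _
      have e2 : ∫ x, (1 : ℝ) * ‖G t x‖ ^ 2 = ‖G t‖ ^ 2 := by
        rw [← real_inner_self_eq_norm_sq, L2.inner_def]
        refine integral_congr_ae (.of_forall fun x => ?_)
        simp
      rw [e1, e2] at hinc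
      -- Convexity of the squared norm: the discarded term is `‖u t - u s‖²`.
      have e3 : ‖u t‖ ^ 2 - ‖u s‖ ^ 2 ≤ 2 * ⟪u t - u s, u t⟫ := by
        have := norm_sub_sq_real (u t) (u t - u s)
        rw [sub_sub_cancel, real_inner_comm] at this
        nlinarith [sq_nonneg ‖u t - u s‖]
      refine e3.trans ?_
      linarith
  -- Here the dissipation is only used through its sign, hence `X = 0`.
  · have := sub_le_neg_integral_of_increment_le (y := fun t => ∫ x, smoothAbs ε (u t x))
      (X := fun _ => 0) (N := fun t => ε⁻¹ * ‖G t‖) hF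
      ((continuous_integral_smoothAbs hε).comp_continuousOn h.continuousOn)
      (fun T => integrableOn_zero) (fun T => (hG T).norm.const_mul _) ?_ le_rfl ht
    · simpa using this
    · filter_upwards [hae] with t ht s hs hst
      have w := hardyWeight_smoothAbs hε
      have hv : MemLp (fun x => (fun r : ℝ => r * (√(r ^ 2 + ε ^ 2))⁻¹) (u t x)) 2 volume := by
        refine MemLp.of_le_mul (c := ε⁻¹) (Lp.memLp (u t))
          ((contDiff_smoothAbs_deriv hε).continuous.comp_aestronglyMeasurable (Lp.memLp (u t)).1)
          (.of_forall fun x => ?_)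
        rw [norm_mul, mul_comm, norm_inv, Real.norm_of_nonneg (Real.sqrt_nonneg _)]
        exact mul_le_mul_of_nonneg_right (inv_anti₀ hε (le_sqrt_sq_add_sq ε _)) (norm_nonneg _)
      have hinc := increment_le hd hη hF heq w (contDiff_smoothAbs_deriv hε) (by simp)
        (funext fun r => (hasDerivAt_smoothAbs_deriv hε r).deriv) hs hst ht.1 ht.2 hv
      have hX : 0 ≤ ∫ x, (ε ^ 2 * (√((u t x) ^ 2 + ε ^ 2))⁻¹ ^ 3) * ‖G t x‖ ^ 2 :=
        integral_nonneg fun x => mul_nonneg (w.nonneg _) (sq_nonneg _)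
      have hX' := mul_nonneg (sub_nonneg.2 hst) (mul_nonneg hκ.le hX)
      have hconv : (∫ x, smoothAbs ε (u t x)) - ∫ x, smoothAbs ε (u s x) ≤
          ⟪u t - u s, hv.toLp _⟫ := by
        have e := inner_toLp (Lp.memLp (u t - u s)) hv
        rw [Lp.toLp_coeFn] at e
        rw [e, ← integral_sub (integrable_smoothAbs hε _) (integrable_smoothAbs hε _)]
        refine integral_mono_ae ((integrable_smoothAbs hε _).sub (integrable_smoothAbs hε _))
          (integrable_inner_of_memLp (Lp.memLp (u t - u s)) hv) ?_
        filter_upwards [Lp.coeFn_sub (u t) (u s)] with x hx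
        rw [hx]
        refine (smoothAbs_sub_le hε (u s x) (u t x)).trans_eq ?_
        simp
      simp only [mul_zero, neg_zero, zero_add]
      linarith

/-- Fatou's lemma as `ε → 0`, since `|s| - ε ≤ smoothAbs ε s ≤ |s|`. -/
lemma eLpNorm_one_le_of_smoothAbs {v : E d → ℝ} (hv : AEStronglyMeasurable v volume) {M : ℝ}
    (hi : ∀ ε > 0, Integrable (fun x => smoothAbs ε (v x)) volume)
    (h : ∀ ε > 0, ∫ x, smoothAbs ε (v x) ≤ M) : eLpNorm v 1 volume ≤ ENNReal.ofReal M := by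
  let ε : ℕ → ℝ := fun n => 1 / ((n : ℝ) + 1)
  have hε : ∀ n, 0 < ε n := fun n => by positivity
  have hεl : Tendsto ε atTop (𝓝 0) := tendsto_one_div_add_atTop_nhds_zero_nat
  have hle : ∀ n, eLpNorm (fun x => smoothAbs (ε n) (v x)) 1 volume ≤ ENNReal.ofReal M := fun n => by
    rw [eLpNorm_one_eq_lintegral_enorm]
    have e : ∀ x, ‖smoothAbs (ε n) (v x)‖ₑ = ENNReal.ofReal (smoothAbs (ε n) (v x)) := fun x =>
      Real.enorm_of_nonneg (smoothAbs_nonneg _ _)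
    simp_rw [e]
    rw [← ofReal_integral_eq_lintegral_ofReal (hi _ (hε n))
      (.of_forall fun x => smoothAbs_nonneg _ _)]
    exact ENNReal.ofReal_le_ofReal (h _ (hε n))
  have hlim : ∀ x, Tendsto (fun n => smoothAbs (ε n) (v x)) atTop (𝓝 |v x|) := fun x => by
    refine tendsto_of_tendsto_of_tendsto_of_le_of_le ?_ tendsto_const_nhds
      (fun n => abs_sub_le_smoothAbs (v x)) (fun n => smoothAbs_le_abs (hε n) _)
    simpa using hεl.const_sub |v x|
  have e : eLpNorm v 1 volume = eLpNorm (fun x => |v x|) 1 volume :=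
    (eLpNorm_norm v).symm
  rw [e]
  refine (Lp.eLpNorm_lim_le_liminf_eLpNorm (fun n =>
    (continuous_smoothAbs (ε n)).comp_aestronglyMeasurable hv) _ (.of_forall hlim)).trans ?_
  exact liminf_le_of_frequently_le' (Frequently.of_forall hle)

/-! ### Integration of the differential inequality and conclusion -/

/-- Algebraic decay from a superlinear differential inequality in integrated form. -/
lemma le_div_rpow_of_sub_le {y : ℝ → ℝ} {A m : ℝ} (hm : 0 < m) (hA : 0 ≤ A)
    (hy : ContinuousOn y (Ici 0)) (hy0 : ∀ t, 0 ≤ t → 0 ≤ y t)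
    (h : ∀ a b, 0 ≤ a → a ≤ b → y b - y a ≤ -((b - a) * (A * y b ^ (1 + 1 / m)))) {t : ℝ}
    (ht : 0 ≤ t) : y t ≤ y 0 / (1 + A / m * y 0 ^ (1 / m) * t) ^ m := by
  have hanti : ∀ a b, 0 ≤ a → a ≤ b → y b ≤ y a := fun a b ha hab => by
    have h1 := h a b ha hab
    have h2 : 0 ≤ (b - a) * (A * y b ^ (1 + 1 / m)) :=
      mul_nonneg (sub_nonneg.2 hab) (mul_nonneg hA (Real.rpow_nonneg (hy0 b (ha.trans hab)) _))
    linarith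
  have hden : 0 ≤ A / m * y 0 ^ (1 / m) * t :=
    mul_nonneg (mul_nonneg (by positivity) (Real.rpow_nonneg (hy0 0 le_rfl) _)) ht
  rcases (hy0 t ht).eq_or_lt with h0 | hpos
  · rw [← h0]
    exact div_nonneg (hy0 0 le_rfl) (Real.rpow_nonneg (by linarith) _)
  have hypos : ∀ s, 0 ≤ s → s ≤ t → 0 < y s := fun s hs hst => hpos.trans_le (hanti s t hs hst)
  have hsub : Icc 0 t ⊆ Ici 0 := fun s hs => hs.1
  have hf : ContinuousOn (fun s => -(y s ^ (-(1 / m)))) (Icc 0 t) :=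
    ((hy.mono hsub).rpow_const fun s hs => Or.inl (hypos s hs.1 hs.2).ne').neg
  -- For a smooth `y` this is the derivative bound `(-y^(-1/m))' ≤ -A/m`. Since `y` is only
  -- continuous, difference quotients are bounded instead, and `y z / y x → 1` as `z` decreases to
  -- `x`.
  have hslope : ∀ x ∈ Ico 0 t, ∀ z, x < z → z ≤ t →
      slope (fun s => -(y s ^ (-(1 / m)))) x z ≤ -(A / m) * (y z / y x) ^ (1 + 1 / m) := by
    intro x hx z hxz hzt
    have hyx := hypos x hx.1 hx.2.le
    have hyz := hypos z (hx.1.trans hxz.le) hzt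
    set q := y z / y x with hq
    have hq0 : 0 < q := div_pos hyz hyx
    have hzq : y z = y x * q := by rw [hq]; field_simp
    -- From `exp r ≥ 1 + r` at `r = -(log q)/m`, and `log q ≤ q - 1`.
    have h1 : 1 + 1 / m * (1 - q) ≤ q ^ (-(1 / m)) := by
      rw [Real.rpow_def_of_pos hq0]
      have h2 := Real.add_one_le_exp (Real.log q * -(1 / m))
      have h3 := Real.log_le_sub_one_of_pos hq0
      have h4 : 0 < 1 / m := by positivity
      nlinarith
    have h2 := h x z hx.1 hxz.le
    rw [slope_def_field, div_le_iff₀ (sub_pos.2 hxz)]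
    have e1 : y z ^ (-(1 / m)) = y x ^ (-(1 / m)) * q ^ (-(1 / m)) := by
      rw [hzq, Real.mul_rpow hyx.le hq0.le]
    have e2 : y z ^ (1 + 1 / m) = y x ^ (1 + 1 / m) * q ^ (1 + 1 / m) := by
      rw [hzq, Real.mul_rpow hyx.le hq0.le]
    have e3 : y x ^ (-(1 / m)) * y x ^ (1 + 1 / m) = y x := by
      rw [← Real.rpow_add hyx]; simp
    have hP : 0 < y x ^ (-(1 / m)) := Real.rpow_pos_of_pos hyx _
    have h3 : (z - x) * A * q ^ (1 + 1 / m) ≤ y x ^ (-(1 / m)) * (1 - q) := by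
      have h4 : y x * ((z - x) * A * q ^ (1 + 1 / m)) ≤ y x * (y x ^ (-(1 / m)) * (1 - q)) := by
        have h5 : (z - x) * (A * (y x ^ (1 + 1 / m) * q ^ (1 + 1 / m))) ≤ y x * (1 - q) := by
          rw [← e2]
          have : y x * (1 - q) = y x - y z := by rw [hzq]; ring
          linarith
        have h6 := mul_le_mul_of_nonneg_left h5 hP.le
        calc _ = y x ^ (-(1 / m)) * ((z - x) * (A * (y x ^ (1 + 1 / m) * q ^ (1 + 1 / m)))) := by
              nth_rewrite 1 [← e3]; ring
          _ ≤ _ := h6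
          _ = _ := by ring
      exact le_of_mul_le_mul_left h4 hyx
    rw [e1]
    have h7 := mul_le_mul_of_nonneg_left h1 hP.le
    have h8 := mul_le_mul_of_nonneg_left h3 (by positivity : 0 ≤ 1 / m)
    have e4 : -(A / m) * q ^ (1 + 1 / m) * (z - x) =
        -(1 / m * ((z - x) * A * q ^ (1 + 1 / m))) := by ring
    rw [e4]
    nlinarith
  have hkey : -(y t ^ (-(1 / m))) ≤ -(y 0 ^ (-(1 / m))) - A / m * t := by
    refine image_le_of_liminf_slope_right_le_deriv_boundary (a := 0) (b := t)
      (B := fun s => -(y 0 ^ (-(1 / m))) - A / m * s) (B' := fun _ => -(A / m)) hf (by simp)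
      (by fun_prop) (fun x _ => ?_) (fun x hx r hr => ?_) (right_mem_Icc.2 ht)
    · have := (((hasDerivAt_id x).const_mul (A / m)).const_sub (-(y 0 ^ (-(1 / m))))).hasDerivWithinAt
        (s := Ici x)
      simpa using this
    · have hyx := hypos x hx.1 hx.2.le
      have hc : Tendsto (fun z => -(A / m) * (y z / y x) ^ (1 + 1 / m)) (𝓝[>] x)
          (𝓝 (-(A / m) * (y x / y x) ^ (1 + 1 / m))) := by
        have h1 : Tendsto y (𝓝[>] x) (𝓝 (y x)) :=
          (hy x hx.1).mono_left (nhdsWithin_mono _ fun z hz => hx.1.trans (le_of_lt hz))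
        exact ((h1.div_const _).rpow_const (Or.inr (by positivity))).const_mul _
      rw [div_self hyx.ne', Real.one_rpow, mul_one] at hc
      refine Eventually.frequently ?_
      filter_upwards [hc.eventually_lt_const hr, Ioo_mem_nhdsGT hx.2] with z hz1 hz2
      exact (hslope x hx z hz2.1 hz2.2.le).trans_lt hz1
  have hy0pos := hypos 0 le_rfl ht
  have hQ : 0 < y 0 ^ (-(1 / m)) := Real.rpow_pos_of_pos hy0pos _
  have e5 : y 0 ^ (-(1 / m)) * (1 + A / m * y 0 ^ (1 / m) * t) ≤ y t ^ (-(1 / m)) := by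
    have : y 0 ^ (-(1 / m)) * y 0 ^ (1 / m) = 1 := by
      rw [← Real.rpow_add hy0pos]; simp
    calc _ = y 0 ^ (-(1 / m)) + A / m * t * (y 0 ^ (-(1 / m)) * y 0 ^ (1 / m)) := by ring
      _ ≤ _ := by rw [this]; linarith
  have h1 := Real.rpow_le_rpow (by positivity) e5 hm.le
  have hinv : ∀ r : ℝ, 0 < r → (r ^ (-(1 / m))) ^ m = r⁻¹ := fun r hr => by
    rw [← Real.rpow_mul hr.le, neg_mul, one_div, inv_mul_cancel₀ hm.ne', Real.rpow_neg_one]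
  rw [Real.mul_rpow hQ.le (by linarith), hinv _ hy0pos, hinv _ hpos] at h1
  have hD : 0 < (1 + A / m * y 0 ^ (1 / m) * t) ^ m := Real.rpow_pos_of_pos (by linarith) _
  rw [le_div_iff₀ hD]
  have h2 := mul_le_mul_of_nonneg_left h1 (mul_pos hpos hy0pos).le
  calc _ = y t * y 0 * ((y 0)⁻¹ * (1 + A / m * y 0 ^ (1 / m) * t) ^ m) := by
        field_simp
    _ ≤ _ := h2
    _ = _ := by field_simp

/-- Decay of the `L²` norm of weak solutions. -/
lemma IsWeakSolution.lpNorm_sq_le (hd : 3 ≤ d) {γ η : ℝ} (hγ : γ < ((d : ℝ) - 2) / 2)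
    (hη : 0 ≤ η) {V u₀ : E d → ℝ} (hV : ∀ᵐ x, ∇ V x = γ • hardyField η x)
    {u : ℝ → Lp ℝ 2 (volume : Measure (E d))} (h : IsWeakSolution V u₀ u)
    (h1 : MemLp u₀ 1 volume) {t : ℝ} (ht : 0 ≤ t) :
    lpNorm (u t) 2 volume ^ 2 ≤
      lpNorm u₀ 2 volume ^ 2 / (1 + decayConst γ u₀ * t) ^ ((d : ℝ) / 2) := by
  have hd0 : (0 : ℝ) < d := by exact_mod_cast (by omega : 0 < d)
  have hκ := min_one_pos hd hγ
  obtain ⟨hCpos, hCmem, -⟩ := nashConst_pos_and_isLeast hd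
  obtain ⟨G, hG, hw, hen, hcon⟩ := h.energy_and_contraction hd hγ hη hV
  set κ := min 1 (1 - 2 * γ / ((d : ℝ) - 2)) with hκdef
  have hnorm : ∀ v : Lp ℝ 2 (volume : Measure (E d)), lpNorm v 2 volume = ‖v‖ := fun v => by
    rw [← toReal_eLpNorm (Lp.memLp v).1, Lp.norm_def]
  have hu0 : lpNorm u₀ 2 volume = ‖u 0‖ := by
    rw [Lp.norm_def, eLpNorm_congr_ae h.initial,
      toReal_eLpNorm ((Lp.memLp (u 0)).1.congr h.initial)]
  set M := lpNorm u₀ 1 volume with hM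
  have hM0 : 0 ≤ M := lpNorm_nonneg
  have hcontr : ∀ s, 0 ≤ s → eLpNorm (u s) 1 volume ≤ ENNReal.ofReal M := fun s hs => by
    refine eLpNorm_one_le_of_smoothAbs (Lp.memLp (u s)).1 (fun ε hε => integrable_smoothAbs hε _)
      fun ε hε => (hcon ε hε s hs).trans ?_
    rw [hM, lpNorm_one_eq_integral_norm h1.1]
    have hi := (memLp_one_iff_integrable.1 h1).norm
    refine integral_mono_ae (integrable_smoothAbs hε _) hi ?_
    filter_upwards [h.initial] with x hx
    rw [hx]
    exact smoothAbs_le_abs hε _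
  have hcontr' : ∀ s, 0 ≤ s → MemLp (u s) 1 volume ∧ lpNorm (u s) 1 volume ≤ M := fun s hs => by
    refine ⟨⟨(Lp.memLp (u s)).1, (hcontr s hs).trans_lt ENNReal.ofReal_lt_top⟩, ?_⟩
    rw [← toReal_eLpNorm (Lp.memLp (u s)).1]
    exact ENNReal.toReal_le_of_le_ofReal hM0 (hcontr s hs)
  have hXint : ∀ a b : ℝ, 0 ≤ a → a ≤ b →
      IntervalIntegrable (fun t => 2 * (κ * ‖G t‖ ^ 2)) volume a b := fun a b ha hab => by
    have : IntegrableOn (fun t => ‖G t‖ ^ 2) (Ioc 0 b) := (hG b).norm.integrable_sq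
    exact (intervalIntegrable_iff_integrableOn_Ioc_of_le hab).2
      (IntegrableOn.mono_set ((this.const_mul κ).const_mul 2) (Ioc_subset_Ioc_left ha))
  have hanti : ∀ a b, 0 ≤ a → a ≤ b → ‖u b‖ ^ 2 ≤ ‖u a‖ ^ 2 := fun a b ha hab => by
    have h2 := hen a b ha hab
    have h3 : 0 ≤ ∫ t in a..b, 2 * (κ * ‖G t‖ ^ 2) :=
      intervalIntegral.integral_nonneg hab fun t _ => by positivity
    linarith
  -- If `‖u₀‖₁ = 0` then `u₀ = 0` almost everywhere and the decay constant is `0`, so monotonicity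
  -- of the norm suffices.
  rcases hM0.eq_or_lt with hMz | hMpos
  · have hz : u₀ =ᵐ[volume] 0 := (lpNorm_eq_zero h1 one_ne_zero).1 (hM ▸ hMz.symm)
    have hz2 : ‖u 0‖ = 0 := by
      rw [← hu0, ← toReal_eLpNorm h1.1, eLpNorm_congr_ae hz]
      simp
    have h2 := hanti 0 t le_rfl ht
    have h3 : decayConst γ u₀ = 0 := by
      rw [decayConst, hu0, hz2, Real.zero_rpow (by positivity)]
      simp
    rw [h3, hnorm, hu0]
    simpa using h2
  -- With `m = d/2`, the rate `(A/m) (‖u₀‖₂²)^(1/m)` is exactly `decayConst γ u₀`.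
  set A := 2 * κ / (nashConst d * M ^ (4 / (d : ℝ))) with hA
  have hMd : 0 < M ^ (4 / (d : ℝ)) := Real.rpow_pos_of_pos hMpos _
  have hA0 : 0 ≤ A := by positivity
  have hpow : ∀ r : ℝ, 0 ≤ r → (r ^ 2) ^ (1 + 1 / ((d : ℝ) / 2)) = r ^ (2 + 4 / (d : ℝ)) :=
    fun r hr => by
      rw [← Real.rpow_natCast, ← Real.rpow_mul hr]
      congr 1
      push_cast
      field_simp
      ring
  have hode := le_div_rpow_of_sub_le (y := fun t => ‖u t‖ ^ 2) (A := A) (m := (d : ℝ) / 2)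
    (by positivity) hA0 (h.continuousOn.norm.pow 2) (fun _ _ => sq_nonneg _) (fun a b ha hab => ?_) ht
  · rw [hnorm, hu0]
    convert hode using 4
    rw [decayConst, hu0, ← hκdef, ← hM, hA]
    have e : (‖u 0‖ ^ 2) ^ (1 / ((d : ℝ) / 2)) = ‖u 0‖ ^ (4 / (d : ℝ)) := by
      rw [← Real.rpow_natCast, ← Real.rpow_mul (norm_nonneg _)]
      congr 1
      push_cast
      field_simp
      ring
    rw [e]
    field_simp
    ring
  · refine (hen a b ha hab).trans (neg_le_neg ?_)
    have hconst : (b - a) * (A * (‖u b‖ ^ 2) ^ (1 + 1 / ((d : ℝ) / 2))) =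
        ∫ _ in a..b, A * (‖u b‖ ^ 2) ^ (1 + 1 / ((d : ℝ) / 2)) := by
      simp only [intervalIntegral.integral_const, smul_eq_mul]
    rw [hconst]
    refine intervalIntegral.integral_mono_ae_restrict hab intervalIntegrable_const
      (hXint a b ha hab) ?_
    rw [← Measure.restrict_congr_set Ioc_ae_eq_Icc]
    have hw' := ae_mono (Measure.restrict_mono (show Ioc a b ⊆ Ioi 0 from
      fun t ht => ha.trans_lt ht.1) le_rfl) hw
    filter_upwards [hw', ae_restrict_mem measurableSet_Ioc] with s hs hms
    have hs0 : 0 ≤ s := ha.trans hms.1.le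
    obtain ⟨m1, m2⟩ := hcontr' s hs0
    have hN := hCmem (u s) (G s) m1 (Lp.memLp _) (Lp.memLp _) hs
    have hGn : lpNorm (G s) 2 volume = ‖G s‖ := by
      rw [← toReal_eLpNorm (Lp.memLp (G s)).1, Lp.norm_def]
    rw [hnorm, hGn] at hN
    -- Since the norm decreases, the integrand on `[a,b]` may be bounded below by its value at the
    -- right endpoint.
    have h2 : ‖u b‖ ^ (2 + 4 / (d : ℝ)) ≤ ‖u s‖ ^ (2 + 4 / (d : ℝ)) := by
      refine Real.rpow_le_rpow (norm_nonneg _) ?_ (by positivity)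
      exact (pow_le_pow_iff_left₀ (norm_nonneg _) (norm_nonneg _) two_ne_zero).1 (hanti s b hs0 hms.2)
    have h3 : nashConst d * lpNorm (u s) 1 volume ^ (4 / (d : ℝ)) * ‖G s‖ ^ 2 ≤
        nashConst d * M ^ (4 / (d : ℝ)) * ‖G s‖ ^ 2 := by
      gcongr
      exact lpNorm_nonneg
    rw [hpow _ (norm_nonneg _), hA, div_mul_eq_mul_div, div_le_iff₀ (by positivity)]
    calc 2 * κ * ‖u b‖ ^ (2 + 4 / (d : ℝ)) ≤
          2 * κ * (nashConst d * M ^ (4 / (d : ℝ)) * ‖G s‖ ^ 2) := by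
          gcongr
          exact h2.trans (hN.trans h3)
      _ = _ := by ring

end FokkerPlanck

theorem mainTheorem1 (d : ℕ) (hd : 3 ≤ d) (γ : ℝ) (hγ : γ < ((d : ℝ) - 2) / 2)
    (V : FokkerPlanck.E d → ℝ)
    (hV : V = FokkerPlanck.potentialOne γ ∨ V = FokkerPlanck.potentialTwo γ) :
    (0 < FokkerPlanck.nashConst d ∧
      IsLeast (FokkerPlanck.nashConstants d) (FokkerPlanck.nashConst d)) ∧
    ∀ (u₀ : FokkerPlanck.E d → ℝ) (u : ℝ → Lp ℝ 2 (volume : Measure (FokkerPlanck.E d))),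
      MemLp u₀ 1 volume → MemLp u₀ 2 volume → 0 ≤ᵐ[volume] u₀ →
      FokkerPlanck.IsWeakSolution V u₀ u →
      ∀ t : ℝ, 0 ≤ t →
        lpNorm (u t) 2 volume ^ 2 ≤
          lpNorm u₀ 2 volume ^ 2 / (1 + FokkerPlanck.decayConst γ u₀ * t) ^ ((d : ℝ) / 2) := by
  refine ⟨FokkerPlanck.nashConst_pos_and_isLeast hd, fun u₀ u h1 _ _ hu t ht => ?_⟩
  obtain ⟨η, hη, hη'⟩ := FokkerPlanck.ae_gradient_potential (by omega) hV
  exact hu.lpNorm_sq_le hd hγ hη hη' h1 ht
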